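/- Let $\mu$ be a measure on $\mathbb R$, and let $\{g_\theta:\theta\in\Theta\}$ and $\{h_\gamma:\gamma\in\Gamma\}$ be two families of probability densities with respect to $\mu$, with $\Theta\subset\mathbb R^{d_g}$ and $\Gamma\subset\mathbb R^{d_h}$ nonempty. Write $P_f$ and $E_f$ for probability and expectation when the observations $X, X_1,X_2,\dots$ are independent with density $f$. Assume that all the distributions in the two families are mutually absolutely continuous and that, almost surely, $\log g_\theta(X)$ and $\log h_\gamma(X)$ are finite and differentiable in $\theta\in\Theta$ and in $\gamma\in\Gamma$, respectively (within $\Theta$, respectively $\Gamma$, at boundary points). Put $l_{\theta\gamma}=\log h_\gamma(X)-\log g_\theta(X)$ and assume: (A1) $\min_{\theta\in\Theta,\gamma\in\Gamma}E_{g_\theta}\{\log g_\theta(X)-\log h_\gamma(X)\}>0$ (the value $+\infty$ of an expectation is allowed). (A2) $\Theta$ and $\Gamma$ are compact with continuously differentiable boundary: near each of its boundary points $p$ the set has the form $\{\varphi\le 0\}$ for a $C^1$ function $\varphi$ with $\nabla\varphi(p)\neq0$. (A3) With $S_1=\sup_{\theta,\gamma}|\nabla_\theta l_{\theta\gamma}|$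 and $S_2=\sup_{\theta,\gamma}|\nabla_\gamma l_{\theta\gamma}|$, there are $\eta,x_0>0$ such that for all $x>x_0$ and $i=1,2$ $$\sup_{\theta\in\Theta,\gamma\in\Gamma}\max\{P_{g_\theta}(S_i>x),P_{h_\gamma}(S_i>x)\}\le e^{-(\log x)^{1+\eta}}.$$ For two densities $g,h$ let $l=\log h(X)-\log g(X)$, $M_g(z)=\int (h/g)^z g\,d\mu$ and $m_g(t)=\max_{z\in\mathbb R}[zt-\log M_g(z)]$; let $M_h$ and $m_h$ be defined in the same way with $g$ and $h$ exchanged. The Chernoff index between $g$ and $h$ is $$\rho=\max_{E_g(l)<t<E_h(l)}\min\{m_g(t),m_h(-t)\}.$$ Let $\rho_{\theta\gamma}$ be the Chernoff index between $g_\theta$ and $h_\gamma$. Consider the generalized likelihood ratio test of $H_0:f\in\{g_\theta\}$ against $H_1:f\in\{h_\gamma\}$ that rejects $H_0$ on $$C_1=\{LR_n>1\},\qquad LR_n=\frac{\max_{\gamma\in\Gamma}\prod_{i=1}^nh_\gamma(X_i)}{\max_{\theta\in\Theta}\prod_{i=1}^ng_\theta(X_i)}.$$ Then the minimum $\min_{\theta\in\Theta,\gamma\in\Gamma}\rho_{\theta\gamma}$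 (the generalized Chernoff index) is attained and finite, and as $n\to\infty$ $$\sup_{\theta\in\Theta}\log P_{g_\theta}(C_1)\;\sim\;\sup_{\gamma\in\Gamma}\log P_{h_\gamma}(C_1^c)\;\sim\;-n\min_{\theta\in\Theta,\gamma\in\Gamma}\rho_{\theta\gamma},$$ where $a_n\sim b_n$ means $a_n/b_n\to1$. -/

import Mathlib

open MeasureTheory Filter Topology
open scoped ENNReal

noncomputable section

namespace SeparateFamilies

/-- `f` is a probability density on the real line with respect to the baseline measure `μ`. -/
structure IsDensity (μ : Measure ℝ) (f : ℝ → ℝ) : Prop where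
  measurable : Measurable f
  nonneg : ∀ x, 0 ≤ f x
  lintegral_eq_one : ∫⁻ x, ENNReal.ofReal (f x) ∂μ = 1

/-- The law of a single observation with density `f`. -/
def law (μ : Measure ℝ) (f : ℝ → ℝ) : Measure ℝ :=
  μ.withDensity fun x => ENNReal.ofReal (f x)

/-- The law of `n` independent observations with density `f`. -/
def sampleLaw (μ : Measure ℝ) (f : ℝ → ℝ) (n : ℕ) : Measure (Fin n → ℝ) :=
  Measure.pi fun _ => law μ f

/-- The extended-real expectation `E f = E f⁺ - E f⁻`.
Every use below is of a variable for which one of the two parts has finite expectation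
(for densities `g`, `h` one has `E_g (log (h / g))⁺ ≤ E_g (h / g) ≤ 1`). -/
def expectation (P : Measure ℝ) (f : ℝ → ℝ) : EReal :=
  ((∫⁻ x, ENNReal.ofReal (f x) ∂P : ℝ≥0∞) : EReal)
    - ((∫⁻ x, ENNReal.ofReal (-f x) ∂P : ℝ≥0∞) : EReal)

/-- The log-likelihood ratio `log h - log g` of a single observation. -/
def logLR (g h : ℝ → ℝ) (x : ℝ) : ℝ := Real.log (h x) - Real.log (g x)

/-! ### The Chernoff index of a simple null `g` against a simple alternative `h` -/

/-- The moment generating function `M_g(z) = ∫ (h / g) ^ z g dμ`, with values in `[0, ∞]`. -/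
def mgfLR (μ : Measure ℝ) (g h : ℝ → ℝ) (z : ℝ) : ℝ≥0∞ :=
  ∫⁻ x, ENNReal.ofReal ((h x / g x) ^ z) ∂(law μ g)

/-- The rate function `m_g(t) = max_z [z t - log M_g(z)]`; points `z` with `M_g(z) = ∞`
contribute `-∞`. -/
def rateFun (μ : Measure ℝ) (g h : ℝ → ℝ) (t : ℝ) : EReal :=
  ⨆ z : ℝ, ((z * t : ℝ) : EReal) - ENNReal.log (mgfLR μ g h z)

/-- The Chernoff index `max_{E_g l < t < E_h l} min {m_g(t), m_h(-t)}`, `l = log h - log g`;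
`m_h` is `m_g` with the roles of `g` and `h` exchanged. -/
def chernoffIndex (μ : Measure ℝ) (g h : ℝ → ℝ) : EReal :=
  ⨆ (t : ℝ) (_ : expectation (law μ g) (logLR g h) < (t : EReal) ∧
      (t : EReal) < expectation (law μ h) (logLR g h)),
    min (rateFun μ g h t) (rateFun μ h g (-t))

/-! ### The generalized likelihood ratio test -/

section Families

variable {dg dh : ℕ}

/-- The maximized likelihood `max_{θ ∈ Θ} ∏ i, f_θ(x_i)`. -/
def maxLikelihood {d n : ℕ} (Θ : Set (EuclideanSpace ℝ (Fin d)))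
    (f : EuclideanSpace ℝ (Fin d) → ℝ → ℝ) (x : Fin n → ℝ) : ℝ≥0∞ :=
  ⨆ θ ∈ Θ, ∏ i, ENNReal.ofReal (f θ (x i))

/-- The rejection region `C_λ = {LR_n > λ}` of the generalized likelihood ratio test. -/
def rejectRegion (Θ : Set (EuclideanSpace ℝ (Fin dg))) (Γ : Set (EuclideanSpace ℝ (Fin dh)))
    (g : EuclideanSpace ℝ (Fin dg) → ℝ → ℝ) (h : EuclideanSpace ℝ (Fin dh) → ℝ → ℝ)
    (lam : ℝ≥0∞) (n : ℕ) : Set (Fin n → ℝ) :=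
  {x | lam < maxLikelihood Γ h x / maxLikelihood Θ g x}

/-- `sup_{θ ∈ Θ} log P_{g_θ}(C)`, with `log 0 = -∞`. -/
def supLogProb {d n : ℕ} (μ : Measure ℝ) (Θ : Set (EuclideanSpace ℝ (Fin d)))
    (f : EuclideanSpace ℝ (Fin d) → ℝ → ℝ) (C : Set (Fin n → ℝ)) : EReal :=
  ⨆ θ ∈ Θ, ENNReal.log (sampleLaw μ (f θ) n C)

/-! ### Conditions on the families -/

/-- The set `K` is a domain with continuously differentiable boundary: near each boundary point
`K` is the region `φ ≤ 0` for a `C¹` function `φ` whose differential does not vanish there. -/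
def HasC1Boundary {d : ℕ} (K : Set (EuclideanSpace ℝ (Fin d))) : Prop :=
  ∀ p ∈ frontier K, ∃ U : Set (EuclideanSpace ℝ (Fin d)), IsOpen U ∧ p ∈ U ∧
    ∃ φ : EuclideanSpace ℝ (Fin d) → ℝ, ContDiffOn ℝ 1 φ U ∧ fderiv ℝ φ p ≠ 0 ∧
      K ∩ U = {x ∈ U | φ x ≤ 0}

/-- All distributions in the two families are mutually absolutely continuous. -/
def MutuallyAC (μ : Measure ℝ) (Θ : Set (EuclideanSpace ℝ (Fin dg)))
    (Γ : Set (EuclideanSpace ℝ (Fin dh)))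
    (g : EuclideanSpace ℝ (Fin dg) → ℝ → ℝ) (h : EuclideanSpace ℝ (Fin dh) → ℝ → ℝ) : Prop :=
  ∀ θ ∈ Θ, ∀ γ ∈ Γ, law μ (g θ) ≪ law μ (h γ) ∧ law μ (h γ) ≪ law μ (g θ)

/-- Almost surely, the log-density `θ ↦ log f_θ(X)` is finite and differentiable on `Θ`
(at boundary points, within `Θ`). -/
def LogDifferentiable {d : ℕ} (μ : Measure ℝ) (Θ : Set (EuclideanSpace ℝ (Fin d)))
    (f : EuclideanSpace ℝ (Fin d) → ℝ → ℝ) : Prop :=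
  ∀ θ₀ ∈ Θ, ∀ᵐ x ∂(law μ (f θ₀)),
    (∀ θ ∈ Θ, 0 < f θ x) ∧ DifferentiableOn ℝ (fun θ => Real.log (f θ x)) Θ

/-- Complete separation: `min_{θ, γ} E_{g_θ} {log g_θ(X) - log h_γ(X)} > 0`. -/
def CompletelySeparated (μ : Measure ℝ) (Θ : Set (EuclideanSpace ℝ (Fin dg)))
    (Γ : Set (EuclideanSpace ℝ (Fin dh)))
    (g : EuclideanSpace ℝ (Fin dg) → ℝ → ℝ) (h : EuclideanSpace ℝ (Fin dh) → ℝ → ℝ) : Prop :=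
  0 < ⨅ θ ∈ Θ, ⨅ γ ∈ Γ,
    expectation (law μ (g θ)) (fun x => Real.log (g θ x) - Real.log (h γ x))

/-- `S₁ = sup_{θ, γ} |∇_θ l_{θγ}|`, with values in `[0, ∞]`. -/
def scoreSup₁ (Θ : Set (EuclideanSpace ℝ (Fin dg))) (Γ : Set (EuclideanSpace ℝ (Fin dh)))
    (g : EuclideanSpace ℝ (Fin dg) → ℝ → ℝ) (h : EuclideanSpace ℝ (Fin dh) → ℝ → ℝ)
    (x : ℝ) : ℝ≥0∞ :=
  ⨆ θ ∈ Θ, ⨆ γ ∈ Γ, ‖gradientWithin (fun θ' => logLR (g θ') (h γ) x) Θ θ‖ₑ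

/-- `S₂ = sup_{θ, γ} |∇_γ l_{θγ}|`, with values in `[0, ∞]`. -/
def scoreSup₂ (Θ : Set (EuclideanSpace ℝ (Fin dg))) (Γ : Set (EuclideanSpace ℝ (Fin dh)))
    (g : EuclideanSpace ℝ (Fin dg) → ℝ → ℝ) (h : EuclideanSpace ℝ (Fin dh) → ℝ → ℝ)
    (x : ℝ) : ℝ≥0∞ :=
  ⨆ θ ∈ Θ, ⨆ γ ∈ Γ, ‖gradientWithin (fun γ' => logLR (g θ) (h γ') x) Γ γ‖ₑ

/-- The tail condition on the score suprema, uniform over both families. Since `x₀` may be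
enlarged, only `x > 1`, where `log x > 0`, matters. -/
def ScoreTail (μ : Measure ℝ) (Θ : Set (EuclideanSpace ℝ (Fin dg)))
    (Γ : Set (EuclideanSpace ℝ (Fin dh)))
    (g : EuclideanSpace ℝ (Fin dg) → ℝ → ℝ) (h : EuclideanSpace ℝ (Fin dh) → ℝ → ℝ) : Prop :=
  ∃ η : ℝ, 0 < η ∧ ∃ x₀ : ℝ, 0 < x₀ ∧ ∀ x : ℝ, x₀ < x →
    ∀ S ∈ ({scoreSup₁ Θ Γ g h, scoreSup₂ Θ Γ g h} : Set (ℝ → ℝ≥0∞)),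
      (⨆ θ ∈ Θ, ⨆ γ ∈ Γ,
        max (law μ (g θ) {y | ENNReal.ofReal x < S y})
          (law μ (h γ) {y | ENNReal.ofReal x < S y}))
        ≤ ENNReal.ofReal (Real.exp (-(Real.log x) ^ (1 + η)))

end Families

/-- `a_n ∼ b_n`, that is `a_n / b_n → 1`. As `toReal` sends `±∞` to `0` and division by `0`
gives `0`, the limit `1` forces both sequences to be finite and nonzero for large `n`. -/
def AsympEquiv (a b : ℕ → EReal) : Prop :=
  Tendsto (fun n => (a n).toReal / (b n).toReal) atTop (𝓝 1)

end SeparateFamilies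

end

/-! Write `l` for the log likelihood ratio of one observation and `M(z) = E_g e ^ (z l)`. For one
pair of distinct, mutually absolutely continuous densities the Chernoff index is `-log min M` over
`[0, 1]` (`chernoffIndex_eq_iSup`). Dominating every `g_θ` and `h_γ` by a fixed `g_{θ₀}`, `M(z)` is
one minus the integral of a nonnegative function continuous in the parameters. Fatou's lemma then
makes the index lower semicontinuous, and compactness gives a least favourable pair with minimal
index `ρ`.

Upper bounds. If `g_θ` is true, the maximized null likelihood is at least the likelihood of `g_θ`
itself, so only the supremum over `Γ` needs control. Unless some score exceeds `e ^ (n c)`, which by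
the tail condition has superexponentially small probability, the log likelihood is so regular that
`e ^ (n ε)` parameters approximate this supremum up to a factor `e`. Markov's inequality for `(h_γ /
g_θ) ^ z` bounds each of them by a multiple of `e ^ (-n ρ)`, and a union bound finishes
(`eventually_sampleLaw_maxLikelihood_le`). The second-kind error is the same with the families
exchanged.

Lower bounds. At the least favourable pair, with laws `P` and `Q`, any test with rejection region
`C` and any small `κ > 0` satisfy `E_P min (1, e ^ (S_n - n κ)) ≤ P(C) + e ^ (-n κ) Q(Cᶜ)`, where
`S_n` is the sum of the `l(X_i)`. The left side decays at rate at most about `ρ + z κ` for some `z <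
1`. By the upper bound already proved, the last term decays at rate about `ρ + κ`, hence is
negligible, and `P(C)` must carry the left side (`eventually_exp_le_of_eventually_compl_le`).
Exchanging `P` and `Q` gives the other error. -/

namespace SeparateFamilies

/-! ### Compact sets with `C¹` boundary: Lipschitz bounds and finite nets -/

section Geometry

variable {d : ℕ} {K : Set (EuclideanSpace ℝ (Fin d))}

/-- The mean value inequality along a segment contained in `K`. -/
lemma abs_sub_le_of_segment_subset {f : EuclideanSpace ℝ (Fin d) → ℝ} {B : ℝ}
    (hf : ∀ p ∈ K, ∃ f' : EuclideanSpace ℝ (Fin d) →L[ℝ] ℝ, HasFDerivWithinAt f f' K p ∧ ‖f'‖ ≤ B)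
    {x y : EuclideanSpace ℝ (Fin d)} (hxy : segment ℝ x y ⊆ K) :
    |f x - f y| ≤ B * dist x y := by
  rw [← Real.norm_eq_abs, dist_eq_norm]
  choose! f' hf' hB using hf
  exact (convex_segment x y).norm_image_sub_le_of_norm_hasFDerivWithin_le
    (fun p hp => (hf' p (hxy hp)).mono hxy) (fun p hp => hB p (hxy hp))
    (right_mem_segment ℝ x y) (left_mem_segment ℝ x y)

/-- Near a boundary point, any two points of `K` are joined by a broken line in `K` whose length is
comparable to their distance. -/
lemma exists_broken_line_of_mem_frontier (hK : HasC1Boundary K) {p : EuclideanSpace ℝ (Fin d)}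
    (hp : p ∈ frontier K) :
    ∃ C : ℝ, 0 ≤ C ∧ ∃ r > 0, ∀ x ∈ K ∩ Metric.ball p r, ∀ y ∈ K ∩ Metric.ball p r,
      ∃ x' y', segment ℝ x x' ⊆ K ∧ segment ℝ x' y' ⊆ K ∧ segment ℝ y' y ⊆ K ∧
        dist x x' + dist x' y' + dist y' y ≤ C * dist x y := by
  obtain ⟨U, hU, hpU, φ, hφ, hφp, hKU⟩ := hK p hp
  obtain ⟨w, hw⟩ : ∃ w, fderiv ℝ φ p w ≠ 0 := by
    by_contra! hcon
    exact hφp (ContinuousLinearMap.ext hcon)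
  set φ' := fderiv ℝ φ p with hφ'
  -- The direction `v` points into `K`: to first order `φ` falls at unit rate along it. The choice
  -- of `c` below keeps the linearization error under half of that rate.
  set v : EuclideanSpace ℝ (Fin d) := (-(φ' w)⁻¹) • w with hv
  have hφv : φ' v = -1 := by
    rw [hv, map_smul, smul_eq_mul]; field_simp
  have hstrict : HasStrictFDerivAt φ φ' p :=
    (hφ.contDiffAt (hU.mem_nhds hpU)).hasStrictFDerivAt one_ne_zero
  set c : ℝ := 1 / (2 * (‖v‖ + 1)) with hc
  have hv0 : 0 ≤ ‖v‖ := norm_nonneg v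
  have hc0 : 0 < c := by positivity
  have hcv : c * ‖v‖ ≤ 1 / 2 := by
    rw [hc, div_mul_eq_mul_div, div_le_div_iff₀ (by positivity) (by positivity)]; linarith
  have hlo := hstrict.isLittleO.def hc0
  rw [nhds_prod_eq] at hlo
  obtain ⟨V, hV, hVlo⟩ := eventually_prod_self_iff'.1 hlo
  obtain ⟨R, hR, hRV⟩ := Metric.mem_nhds_iff.1 (inter_mem hV (hU.mem_nhds hpU))
  have hest : ∀ a ∈ Metric.ball p R, ∀ b ∈ Metric.ball p R,
      |φ a - φ b - φ' (a - b)| ≤ c * ‖a - b‖ := fun a ha b hb =>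
    hVlo a (hRV ha).1 b (hRV hb).1
  have hKball : ∀ a ∈ Metric.ball p R, φ a ≤ 0 → a ∈ K := fun a ha hle => by
    have : a ∈ K ∩ U := by rw [hKU]; exact ⟨(hRV ha).2, hle⟩
    exact this.1
  have hKφ : ∀ a ∈ Metric.ball p R, a ∈ K → φ a ≤ 0 := fun a ha haK => by
    have : a ∈ K ∩ U := ⟨haK, (hRV ha).2⟩
    rw [hKU] at this
    exact this.2
  set L : ℝ := ‖φ'‖ + c with hL
  have hL0 : 0 < L := by positivity
  have hLip : ∀ a ∈ Metric.ball p R, ∀ b ∈ Metric.ball p R, φ a - φ b ≤ L * ‖a - b‖ := by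
    intro a ha b hb
    have h1 := (abs_le.1 (hest a ha b hb)).2
    have h2 := (le_abs_self _).trans (φ'.le_opNorm (a - b))
    rw [hL, add_mul]; linarith
  have hdown : ∀ a ∈ Metric.ball p R, ∀ τ : ℝ, 0 ≤ τ → a + τ • v ∈ Metric.ball p R →
      φ (a + τ • v) ≤ φ a - τ / 2 := by
    intro a ha τ hτ hb
    have h1 := (abs_le.1 (hest _ hb a ha)).2
    rw [add_sub_cancel_left, map_smul, hφv, norm_smul, Real.norm_of_nonneg hτ, smul_eq_mul] at h1
    nlinarith
  -- Two points of the `r`-ball are at distance at most `2 * r`, so the shift by `s • v` below has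
  -- length at most `4 * L * r * ‖v‖` and stays inside the `R`-ball.
  set r : ℝ := R / (2 * (1 + 4 * L * ‖v‖)) with hr
  have hr0 : 0 < r := by positivity
  have hrR : r + 4 * L * r * ‖v‖ < R := by
    have : r * (2 * (1 + 4 * L * ‖v‖)) = R := by rw [hr]; field_simp
    nlinarith
  refine ⟨4 * L * ‖v‖ + 1, by positivity, r, hr0, ?_⟩
  rintro x ⟨hxK, hxr⟩ y ⟨hyK, hyr⟩
  -- Shifting by `s • v` lowers `φ` by at least `s / 2 = L * dist x y`, which is all that `φ` can
  -- regain along the segment between the two shifted points.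
  set s : ℝ := 2 * L * dist x y with hs
  have hs0 : 0 ≤ s := by positivity
  have hdxy : dist x y ≤ 2 * r := by
    have := dist_triangle_right x y p
    rw [Metric.mem_ball] at hxr hyr
    linarith
  have hsv : s * ‖v‖ ≤ 4 * L * r * ‖v‖ := by
    refine mul_le_mul_of_nonneg_right ?_ hv0
    rw [hs]; nlinarith
  have hbase : ∀ a ∈ Metric.ball p r, a ∈ Metric.ball p R ∧ a + s • v ∈ Metric.ball p R := by
    intro a ha
    rw [Metric.mem_ball, dist_eq_norm] at ha
    have h4 : 0 ≤ 4 * L * r * ‖v‖ := by positivity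
    refine ⟨by rw [Metric.mem_ball, dist_eq_norm]; linarith, ?_⟩
    rw [Metric.mem_ball, dist_eq_norm]
    calc ‖a + s • v - p‖ = ‖(a - p) + s • v‖ := by congr 1; abel
      _ ≤ ‖a - p‖ + s * ‖v‖ := by
        refine (norm_add_le _ _).trans ?_
        rw [norm_smul, Real.norm_of_nonneg hs0]
      _ < R := by linarith
  have hup : ∀ a ∈ K, a ∈ Metric.ball p r → segment ℝ a (a + s • v) ⊆ K := by
    intro a haK har b hb
    have hbR : b ∈ Metric.ball p R :=
      (convex_ball p R).segment_subset (hbase a har).1 (hbase a har).2 hb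
    rw [segment_eq_image'] at hb
    obtain ⟨t, ht, rfl⟩ := hb
    simp only [add_sub_cancel_left, smul_smul] at hbR ⊢
    have h0 : 0 ≤ t * s := mul_nonneg ht.1 hs0
    refine hKball _ hbR ((hdown a (hbase a har).1 _ h0 hbR).trans ?_)
    linarith [hKφ a (hbase a har).1 haK]
  refine ⟨x + s • v, y + s • v, hup x hxK hxr, ?_, ?_, ?_⟩
  · intro b hb
    have hbR : b ∈ Metric.ball p R :=
      (convex_ball p R).segment_subset (hbase x hxr).2 (hbase y hyr).2 hb
    refine hKball b hbR ?_
    have h1 := hLip b hbR _ (hbase x hxr).2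
    have h2 := hdown x (hbase x hxr).1 s hs0 (hbase x hxr).2
    have h3 := hKφ x (hbase x hxr).1 hxK
    have h4 : ‖b - (x + s • v)‖ ≤ dist x y := by
      rw [segment_eq_image'] at hb
      obtain ⟨t, ht, rfl⟩ := hb
      rw [add_sub_cancel_left, norm_smul, Real.norm_of_nonneg ht.1, add_sub_add_right_eq_sub,
        dist_comm, dist_eq_norm]
      exact mul_le_of_le_one_left (norm_nonneg _) ht.2
    have h5 := mul_le_mul_of_nonneg_left h4 hL0.le
    linarith
  · rw [segment_symm]; exact hup y hyK hyr
  · have h1 : ∀ a : EuclideanSpace ℝ (Fin d), dist a (a + s • v) = s * ‖v‖ := fun a => by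
      rw [dist_self_add_right, norm_smul, Real.norm_of_nonneg hs0]
    rw [dist_comm (y + s • v) y, h1, h1, dist_add_right, hs]
    linarith

/-- On a compact set with `C¹` boundary, a differentiable function with bounded differential is
Lipschitz at small scales, with constants that do not depend on the function. -/
lemma exists_lipschitz_scale (hKc : IsCompact K) (hK : HasC1Boundary K) :
    ∃ C : ℝ, 0 ≤ C ∧ ∃ δ > 0, ∀ x ∈ K, ∀ y ∈ K, dist x y < δ →
      ∀ (f : EuclideanSpace ℝ (Fin d) → ℝ) (B : ℝ),
        (∀ p ∈ K, ∃ f' : EuclideanSpace ℝ (Fin d) →L[ℝ] ℝ, HasFDerivWithinAt f f' K p ∧ ‖f'‖ ≤ B) →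
        |f x - f y| ≤ C * B * dist x y := by
  -- Only the first point is confined to `s`, the second ranges over all of `K`; this makes the
  -- property stable under unions.
  refine hKc.induction_on (p := fun s => ∃ C : ℝ, 0 ≤ C ∧ ∃ δ > 0, ∀ x ∈ s, ∀ y ∈ K, dist x y < δ →
      ∀ (f : EuclideanSpace ℝ (Fin d) → ℝ) (B : ℝ),
        (∀ p ∈ K, ∃ f' : EuclideanSpace ℝ (Fin d) →L[ℝ] ℝ, HasFDerivWithinAt f f' K p ∧ ‖f'‖ ≤ B) →
        |f x - f y| ≤ C * B * dist x y) ?_ ?_ ?_ ?_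
  · exact ⟨0, le_rfl, 1, one_pos, by simp⟩
  · rintro s t hst ⟨C, hC, δ, hδ, h⟩
    exact ⟨C, hC, δ, hδ, fun x hx => h x (hst hx)⟩
  · rintro s t ⟨C, hC, δ, hδ, h⟩ ⟨C', hC', δ', hδ', h'⟩
    refine ⟨max C C', hC.trans (le_max_left _ _), min δ δ', lt_min hδ hδ', ?_⟩
    intro x hx y hy hxy f B hf
    have hB0 : 0 ≤ B := by
      obtain ⟨f', -, hf'⟩ := hf y hy
      exact (norm_nonneg _).trans hf'
    rcases hx with hx | hx
    · refine (h x hx y hy (hxy.trans_le (min_le_left _ _)) f B hf).trans ?_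
      gcongr; exact le_max_left _ _
    · refine (h' x hx y hy (hxy.trans_le (min_le_right _ _)) f B hf).trans ?_
      gcongr; exact le_max_right _ _
  · intro p hp
    have key : ∃ C : ℝ, 0 ≤ C ∧ ∃ r > 0, ∀ x ∈ K ∩ Metric.ball p r, ∀ y ∈ K ∩ Metric.ball p r,
        ∀ (f : EuclideanSpace ℝ (Fin d) → ℝ) (B : ℝ),
        (∀ p ∈ K, ∃ f' : EuclideanSpace ℝ (Fin d) →L[ℝ] ℝ, HasFDerivWithinAt f f' K p ∧ ‖f'‖ ≤ B) →
        |f x - f y| ≤ C * B * dist x y := by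
      by_cases hpi : p ∈ interior K
      · obtain ⟨r, hr, hrK⟩ := Metric.mem_nhds_iff.1 (mem_interior_iff_mem_nhds.1 hpi)
        refine ⟨1, zero_le_one, r, hr, fun x hx y hy f B hf => ?_⟩
        rw [one_mul]
        exact abs_sub_le_of_segment_subset hf
          (((convex_ball p r).segment_subset hx.2 hy.2).trans hrK)
      · obtain ⟨C, hC, r, hr, h⟩ := exists_broken_line_of_mem_frontier hK
          (p := p) ⟨subset_closure hp, hpi⟩
        refine ⟨C, hC, r, hr, fun x hx y hy f B hf => ?_⟩
        obtain ⟨x', y', h1, h2, h3, h4⟩ := h x hx y hy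
        have e1 := abs_sub_le_of_segment_subset hf h1
        have e2 := abs_sub_le_of_segment_subset hf h2
        have e3 := abs_sub_le_of_segment_subset hf h3
        have hB0 : 0 ≤ B := by
          obtain ⟨f', -, hf'⟩ := hf p hp
          exact (norm_nonneg _).trans hf'
        have e4 := mul_le_mul_of_nonneg_left h4 hB0
        have e5 := abs_sub_le (f x) (f x') (f y)
        have e6 := abs_sub_le (f x') (f y') (f y)
        nlinarith
    obtain ⟨C, hC, r, hr, h⟩ := key
    -- Half the radius is kept in reserve: a point of `K` within `r / 2` of this piece still lies in
    -- the `r`-ball.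
    refine ⟨K ∩ Metric.ball p (r / 2), inter_mem self_mem_nhdsWithin
      (mem_nhdsWithin_of_mem_nhds (Metric.ball_mem_nhds p (by positivity))), C, hC, r / 2,
      by positivity, fun x hx y hy hxy => h x ⟨hx.1, ?_⟩ y ⟨hy, ?_⟩⟩
    · exact Metric.ball_subset_ball (by linarith) hx.2
    · have h1 := hx.2
      rw [Metric.mem_ball] at h1 ⊢
      have := dist_triangle_left y p x
      linarith

/-- A bounded set has `ε`-nets of size `O(ε ^ (-d))`. -/
lemma exists_finite_net (hK : Bornology.IsBounded K) :
    ∃ A : ℝ, 0 < A ∧ ∀ ε : ℝ, 0 < ε → ε ≤ 1 → ∃ T : Finset (EuclideanSpace ℝ (Fin d)),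
      (T : Set (EuclideanSpace ℝ (Fin d))) ⊆ K ∧ (T.card : ℝ) ≤ (A / ε) ^ d ∧
      ∀ x ∈ K, ∃ y ∈ T, dist x y < ε := by
  classical
  obtain ⟨R, hR, hKR⟩ := hK.subset_closedBall_lt 0 0
  -- Cut space into cubes of side `ε / D` and keep one point of `K` from each cube that meets `K`.
  -- Two points of a cube are at distance at most `d * m`, and `d + 1` in place of `d` makes this
  -- strictly less than `ε`, also when `d = 0`.
  set D : ℝ := d + 1 with hD
  have hD0 : 0 < D := by positivity
  -- There are `2 * N + 1 ≤ 2 * R * D / ε + 3` cells on each axis, and `3 ≤ 3 / ε` because `ε ≤ 1`.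
  refine ⟨2 * R * D + 3, by positivity, fun ε hε hε1 => ?_⟩
  set m : ℝ := ε / D with hm
  have hm0 : 0 < m := by positivity
  let q : EuclideanSpace ℝ (Fin d) → Fin d → ℤ := fun x i => ⌊x i / m⌋
  let N : ℤ := ⌈R / m⌉
  have hcoord : ∀ x ∈ K, ∀ i, |x i| ≤ R := fun x hx i => by
    have h1 := hKR hx
    rw [mem_closedBall_zero_iff] at h1
    exact (PiLp.norm_apply_le x i).trans h1
  have hq : q '' K ⊆ ((Fintype.piFinset fun _ : Fin d => Finset.Ico (-N) (N + 1) :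
      Finset (Fin d → ℤ)) : Set (Fin d → ℤ)) := by
    rintro _ ⟨x, hx, rfl⟩
    simp only [Finset.mem_coe, Fintype.mem_piFinset, Finset.mem_Ico]
    intro i
    have h1 := abs_le.1 (hcoord x hx i)
    have h2 : R / m ≤ N := Int.le_ceil _
    constructor
    · rw [Int.le_floor]
      push_cast
      have : -R / m ≤ x i / m := div_le_div_of_nonneg_right h1.1 hm0.le
      rw [neg_div] at this
      linarith
    · rw [Int.floor_lt]
      push_cast
      have : x i / m ≤ R / m := div_le_div_of_nonneg_right h1.2 hm0.le
      linarith
  have hfin : (q '' K).Finite := (Finset.finite_toSet _).subset hq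
  choose! rep hrep using fun b (hb : b ∈ q '' K) => hb
  refine ⟨hfin.toFinset.image rep, ?_, ?_, ?_⟩
  · intro y hy
    simp only [Finset.coe_image, Set.Finite.coe_toFinset, Set.mem_image] at hy
    obtain ⟨b, hb, rfl⟩ := hy
    exact (hrep b (by simpa using hb)).1
  · have h1 : (hfin.toFinset.image rep).card ≤ (2 * N + 1).toNat ^ d := by
      refine Finset.card_image_le.trans ((Finset.card_le_card
        (t := Fintype.piFinset fun _ : Fin d => Finset.Ico (-N) (N + 1)) ?_).trans ?_)
      · intro b hb
        exact hq (by simpa using hb)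
      · rw [Fintype.card_piFinset]
        simp only [Int.card_Ico, Finset.prod_const, Finset.card_univ, Fintype.card_fin]
        refine Nat.pow_le_pow_left (Int.toNat_le_toNat ?_) d
        linarith
    have hN0 : 0 ≤ N := Int.ceil_nonneg (by positivity)
    have h2 : (((2 * N + 1).toNat : ℕ) : ℝ) = 2 * N + 1 := by
      have : (((2 * N + 1).toNat : ℕ) : ℤ) = 2 * N + 1 := Int.toNat_of_nonneg (by linarith)
      exact_mod_cast this
    calc ((hfin.toFinset.image rep).card : ℝ) ≤ (((2 * N + 1).toNat : ℕ) : ℝ) ^ d := by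
          exact_mod_cast h1
      _ ≤ ((2 * R * D + 3) / ε) ^ d := by
        refine pow_le_pow_left₀ (by positivity) ?_ d
        rw [h2]
        have h3 : (N : ℝ) < R / m + 1 := Int.ceil_lt_add_one _
        have h4 : R / m = R * D / ε := by rw [hm]; field_simp
        rw [le_div_iff₀ hε]
        rw [h4] at h3
        have h5 : R * D / ε * ε = R * D := by field_simp
        nlinarith
  · intro x hx
    refine ⟨rep (q x), Finset.mem_image_of_mem _ (by simpa using ⟨x, hx, rfl⟩), ?_⟩
    obtain ⟨-, hqq⟩ := hrep (q x) ⟨x, hx, rfl⟩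
    have hco : ∀ i, |x i - rep (q x) i| ≤ m := fun i => by
      have h1 : ⌊(rep (q x)) i / m⌋ = ⌊x i / m⌋ := congrFun hqq i
      have h2 := Int.abs_sub_lt_one_of_floor_eq_floor h1
      rw [← sub_div, abs_div, abs_of_pos hm0, div_lt_one hm0, abs_sub_comm] at h2
      exact h2.le
    rw [EuclideanSpace.dist_eq]
    calc √(∑ i, dist (x i) (rep (q x) i) ^ 2) ≤ √(∑ _i : Fin d, m ^ 2) := by
          gcongr with i _
          exact hco i
      _ = √(d * m ^ 2) := by simp
      _ ≤ √((d * m) ^ 2) := by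
        refine Real.sqrt_le_sqrt ?_
        rw [mul_pow]
        gcongr
        exact_mod_cast Nat.le_self_pow two_ne_zero d
      _ = d * m := Real.sqrt_sq (by positivity)
      _ < ε := by
        have : D * m = ε := by rw [hm]; field_simp
        rw [hD] at this
        linarith

end Geometry

lemma eventually_exp_neg_le {a b : ℝ} (ha : 0 < a) (hb : 0 < b) :
    ∀ᶠ n : ℕ in atTop, Real.exp (-(n * a)) ≤ b := by
  have h1 : Tendsto (fun n : ℕ => Real.exp (-(n * a))) atTop (𝓝 0) :=
    Real.tendsto_exp_neg_atTop_nhds_zero.comp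
      (tendsto_natCast_atTop_atTop.atTop_mul_const ha)
  exact h1.eventually_le_const hb

/-! ### Chernoff bounds for independent samples -/

section Sampling

open ProbabilityTheory

variable {Ω : Type*} [MeasurableSpace Ω] {P Q : Measure Ω} [IsProbabilityMeasure P]

lemma lintegral_pi_prod {n : ℕ} {f : Fin n → Ω → ℝ≥0∞} (hf : ∀ i, Measurable (f i)) :
    ∫⁻ x, ∏ i, f i (x i) ∂(Measure.pi fun _ : Fin n => P) = ∏ i, ∫⁻ y, f i y ∂P := by
  rw [lintegral_prod_eq_prod_lintegral_of_indepFun Finset.univ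
    (fun i (x : Fin n → Ω) => f i (x i))
    (iIndepFun_pi (μ := fun _ => P) (X := f) fun i => (hf i).aemeasurable)
    fun i => (hf i).comp (measurable_pi_apply i)]
  refine Finset.prod_congr rfl fun i _ => ?_
  exact (measurePreserving_eval (fun _ : Fin n => P) i).lintegral_comp (hf i)

lemma pi_withDensity {n : ℕ} {f : Ω → ℝ≥0∞} (hf : Measurable f)
    [IsProbabilityMeasure (P.withDensity f)] :
    Measure.pi (fun _ : Fin n => P.withDensity f)
      = (Measure.pi fun _ : Fin n => P).withDensity fun x => ∏ i, f (x i) := by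
  refine Measure.pi_eq fun s hs => ?_
  rw [withDensity_apply _ (MeasurableSet.univ_pi hs),
    ← lintegral_indicator (MeasurableSet.univ_pi hs)]
  have : ∀ x : Fin n → Ω, (Set.univ.pi s).indicator (fun x => ∏ i, f (x i)) x
      = ∏ i, (s i).indicator f (x i) := by
    intro x
    by_cases hx : x ∈ Set.univ.pi s
    · rw [Set.indicator_of_mem hx]
      exact Finset.prod_congr rfl fun i _ => (Set.indicator_of_mem (hx i trivial) f).symm
    · rw [Set.indicator_of_notMem hx]
      simp only [Set.mem_pi, Set.mem_univ, true_implies, not_forall] at hx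
      obtain ⟨i, hi⟩ := hx
      exact (Finset.prod_eq_zero (Finset.mem_univ i) (Set.indicator_of_notMem hi f)).symm
  simp_rw [this]
  rw [lintegral_pi_prod fun i => hf.indicator (hs i)]
  exact Finset.prod_congr rfl fun i _ => by
    rw [lintegral_indicator (hs i), withDensity_apply _ (hs i)]

/-- The probability that some observation falls into a (possibly nonmeasurable) set. -/
lemma pi_exists_mem_le {n : ℕ} (A : Set Ω) :
    (Measure.pi fun _ : Fin n => P) {x | ∃ i, x i ∈ A} ≤ n * P A := by
  have h1 : {x : Fin n → Ω | ∃ i, x i ∈ A} ⊆ ⋃ i, Function.eval i ⁻¹' toMeasurable P A := by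
    rintro x ⟨i, hi⟩
    exact Set.mem_iUnion.2 ⟨i, subset_toMeasurable P A hi⟩
  refine (measure_mono h1).trans ((measure_iUnion_fintype_le _ _).trans (le_of_eq ?_))
  simp_rw [(measurePreserving_eval (fun _ : Fin n => P) _).measure_preimage
    (measurableSet_toMeasurable P A).nullMeasurableSet, measure_toMeasurable]
  simp

lemma lintegral_exp_mul_sum {X : Ω → ℝ} (hX : Measurable X) {z : ℝ}
    (hz : z ∈ integrableExpSet X P) (n : ℕ) :
    ∫⁻ x, ENNReal.ofReal (Real.exp (z * ∑ i, X (x i))) ∂(Measure.pi fun _ : Fin n => P)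
      = ENNReal.ofReal (mgf X P z ^ n) := by
  have h1 : ∀ x : Fin n → Ω, ENNReal.ofReal (Real.exp (z * ∑ i, X (x i)))
      = ∏ i, ENNReal.ofReal (Real.exp (z * X (x i))) := fun x => by
    rw [Finset.mul_sum, Real.exp_sum, ENNReal.ofReal_prod_of_nonneg fun i _ => (Real.exp_pos _).le]
  simp_rw [h1]
  rw [lintegral_pi_prod (f := fun _ y => ENNReal.ofReal (Real.exp (z * X y)))
    fun i => by fun_prop]
  rw [Finset.prod_const, Finset.card_univ, Fintype.card_fin, ENNReal.ofReal_pow mgf_nonneg, mgf,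
    ofReal_integral_eq_lintegral_ofReal hz (ae_of_all _ fun _ => (Real.exp_pos _).le)]

/-- At an interior local minimum the moment generating function is flat to first order. -/
lemma exists_mgf_lt_of_isLocalMin {X : Ω → ℝ} {z : ℝ}
    (hz : z ∈ interior (integrableExpSet X P)) (hmin : IsLocalMin (mgf X P) z) {δ : ℝ}
    (hδ : 0 < δ) :
    ∃ s > 0, z + s ∈ integrableExpSet X P ∧ z - s ∈ integrableExpSet X P ∧
      mgf X P (z + s) * Real.exp (-(δ * s)) < mgf X P z ∧
      mgf X P (z - s) * Real.exp (-(δ * s)) < mgf X P z := by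
  have hd : HasDerivAt (mgf X P) 0 z := by
    have h1 := hasDerivAt_mgf hz
    rwa [hmin.hasDerivAt_eq_zero h1] at h1
  have hpos : 0 < mgf X P z := mgf_pos (interior_subset (s := integrableExpSet X P) hz)
  -- The moment generating function has slope zero at `z`, so the damping factor alone decides: the
  -- product has slope `-δ M(z) < 0` at `s = 0`, whatever the direction `σ`.
  have aux : ∀ σ : ℝ, ∀ᶠ s in 𝓝[>] (0 : ℝ),
      mgf X P (z + σ * s) * Real.exp (-(δ * s)) < mgf X P z := by
    intro σ
    have h1 : HasDerivAt (fun s : ℝ => mgf X P (z + σ * s) * Real.exp (-(δ * s)))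
        (-(δ * mgf X P z)) 0 := by
      have e1 : HasDerivAt (fun s : ℝ => z + σ * s) σ 0 := by
        simpa using ((hasDerivAt_id (0 : ℝ)).const_mul σ).const_add z
      have hd' : HasDerivAt (mgf X P) 0 (z + σ * 0) := by simpa using hd
      have e2 := hd'.comp (0 : ℝ) e1
      have e3 : HasDerivAt (fun s : ℝ => Real.exp (-(δ * s))) (-δ) 0 := by
        have := ((hasDerivAt_id (0 : ℝ)).const_mul (-δ)).exp
        simpa using this
      have e4 := e2.mul e3
      have e5 : 0 * σ * Real.exp (-(δ * 0)) + (mgf X P ∘ fun s => z + σ * s) 0 * -δ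
          = -(δ * mgf X P z) := by
        simp only [Function.comp_apply, mul_zero, add_zero]
        ring
      rw [← e5]
      exact e4
    have h2 := h1.tendsto_slope_zero_right
    have h3 : ∀ᶠ s in 𝓝[>] (0 : ℝ), s⁻¹ • (mgf X P (z + σ * (0 + s)) * Real.exp (-(δ * (0 + s)))
        - mgf X P (z + σ * 0) * Real.exp (-(δ * 0))) < 0 :=
      h2.eventually_lt_const (by nlinarith)
    filter_upwards [h3, self_mem_nhdsWithin] with s hs hs0
    have hs0 : 0 < s := hs0
    simp only [zero_add, mul_zero, add_zero, neg_zero, Real.exp_zero, mul_one, smul_eq_mul] at hs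
    have := (pos_iff_neg_of_mul_neg hs).1 (inv_pos.2 hs0)
    linarith
  have hin : ∀ σ : ℝ, ∀ᶠ s in 𝓝[>] (0 : ℝ), z + σ * s ∈ integrableExpSet X P := by
    intro σ
    have hc : Tendsto (fun s : ℝ => z + σ * s) (𝓝 0) (𝓝 z) := by
      have : Continuous fun s : ℝ => z + σ * s := by fun_prop
      simpa using this.tendsto 0
    exact nhdsWithin_le_nhds (hc (mem_interior_iff_mem_nhds.1 hz))
  obtain ⟨s, h1, h2, h3, h4, h5⟩ := ((aux 1).and ((aux (-1)).and ((hin 1).and ((hin (-1)).and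
    self_mem_nhdsWithin)))).exists
  refine ⟨s, h5, ?_, ?_, ?_, ?_⟩ <;> [simpa using h3; skip; simpa using h1; skip]
  · simpa [← sub_eq_add_neg] using h4
  · simpa [← sub_eq_add_neg] using h2

/-- Chernoff's lower bound: at an interior minimum `z` of the moment generating function of `X`,
`E min (1, e ^ S_n)` decays at most like `M(z) ^ n`. -/
lemma eventually_mgf_pow_le_lintegral_min {X : Ω → ℝ} (hX : Measurable X) {z : ℝ}
    (hz : z ∈ interior (integrableExpSet X P)) (hz01 : z ∈ Set.Icc (0 : ℝ) 1)
    (hmin : IsLocalMin (mgf X P) z) {δ : ℝ} (hδ : 0 < δ) :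
    ∀ᶠ n : ℕ in atTop, ENNReal.ofReal (Real.exp (-(n * δ)) * mgf X P z ^ n) ≤
      ∫⁻ x, ENNReal.ofReal (min 1 (Real.exp (∑ i, X (x i)))) ∂(Measure.pi fun _ : Fin n => P) := by
  obtain ⟨s, hs, hs1, hs2, hlt1, hlt2⟩ := exists_mgf_lt_of_isLocalMin hz hmin (half_pos hδ)
  have hpos : 0 < mgf X P z := mgf_pos (interior_subset (s := integrableExpSet X P) hz)
  set m := mgf X P z with hm
  set q₁ := mgf X P (z + s) * Real.exp (-(δ / 2 * s)) with hq1
  set q₂ := mgf X P (z - s) * Real.exp (-(δ / 2 * s)) with hq2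
  have hq1pos : 0 ≤ q₁ := mul_nonneg mgf_nonneg (Real.exp_pos _).le
  have hq2pos : 0 ≤ q₂ := mul_nonneg mgf_nonneg (Real.exp_pos _).le
  have hsmall : ∀ q : ℝ, 0 ≤ q → q < m → ∀ᶠ n : ℕ in atTop, q ^ n ≤ m ^ n / 4 := by
    intro q hq hqm
    have h1 := tendsto_pow_atTop_nhds_zero_of_lt_one (div_nonneg hq hpos.le)
      ((div_lt_one hpos).2 hqm)
    filter_upwards [h1.eventually_le_const (show (0 : ℝ) < 1 / 4 by norm_num)] with n hn
    rw [div_pow, div_le_iff₀ (pow_pos hpos n)] at hn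
    linarith
  filter_upwards [hsmall q₁ hq1pos hlt1, hsmall q₂ hq2pos hlt2,
    eventually_exp_neg_le (half_pos hδ) (show (0 : ℝ) < 1 / 2 by norm_num)] with n h1 h2 h3
  set ν := Measure.pi fun _ : Fin n => P with hν
  set I := ∫⁻ x, ENNReal.ofReal (min 1 (Real.exp (∑ i, X (x i)))) ∂ν with hI
  have hI1 : I ≤ 1 := by
    calc I ≤ ∫⁻ _, 1 ∂ν := lintegral_mono fun x => by
          rw [← ENNReal.ofReal_one]; exact ENNReal.ofReal_le_ofReal (min_le_left _ _)
      _ = 1 := by simp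
  have hIreal : I = ENNReal.ofReal I.toReal :=
    (ENNReal.ofReal_toReal (hI1.trans_lt (by simp)).ne).symm
  -- When `|S| ≤ n δ / 2`, both `z S` and `(z - 1) S` are at most `n δ / 2`, as `z` lies in `[0,
  -- 1]`. Beyond that range the extra exponent `± s` pays for the factor `e ^ (-n δ s / 2)`. After
  -- integration the last two terms are `q₁ ^ n` and `q₂ ^ n`, together at most half of `m ^ n`;
  -- this replaces a law of large numbers under the tilted measure.
  have hpt : ∀ S : ℝ, Real.exp (z * S) ≤ Real.exp (n * (δ / 2)) * min 1 (Real.exp S)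
      + (Real.exp (-(n * (δ / 2 * s))) * Real.exp ((z + s) * S)
        + Real.exp (-(n * (δ / 2 * s))) * Real.exp ((z - s) * S)) := by
    intro S
    have p0 : 0 ≤ Real.exp (n * (δ / 2)) * min 1 (Real.exp S) := by positivity
    have p1 : 0 < Real.exp (-(n * (δ / 2 * s))) * Real.exp ((z + s) * S) := by positivity
    have p2 : 0 < Real.exp (-(n * (δ / 2 * s))) * Real.exp ((z - s) * S) := by positivity
    by_cases hS1 : n * (δ / 2) < S
    · have : Real.exp (z * S) ≤ Real.exp (-(n * (δ / 2 * s))) * Real.exp ((z + s) * S) := by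
        rw [← Real.exp_add]; refine Real.exp_le_exp.2 ?_; nlinarith
      linarith
    by_cases hS2 : S < -(n * (δ / 2))
    · have : Real.exp (z * S) ≤ Real.exp (-(n * (δ / 2 * s))) * Real.exp ((z - s) * S) := by
        rw [← Real.exp_add]; refine Real.exp_le_exp.2 ?_; nlinarith
      linarith
    have hnδ : 0 ≤ n * (δ / 2) := by positivity
    have : Real.exp (z * S) ≤ Real.exp (n * (δ / 2)) * min 1 (Real.exp S) := by
      rw [mul_min_of_nonneg _ _ (Real.exp_pos _).le, mul_one, ← Real.exp_add]
      refine le_min (Real.exp_le_exp.2 ?_) (Real.exp_le_exp.2 ?_)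
      · rcases le_total 0 S with h | h <;> nlinarith [hz01.1, hz01.2]
      · rcases le_total 0 S with h | h <;> nlinarith [hz01.1, hz01.2]
    linarith
  have hle : ENNReal.ofReal (m ^ n) ≤ ENNReal.ofReal (Real.exp (n * (δ / 2)) * I.toReal
      + (q₁ ^ n + q₂ ^ n)) := by
    have hq : ∀ t, Real.exp (-(n * (δ / 2 * s))) * mgf X P t ^ n
        = (mgf X P t * Real.exp (-(δ / 2 * s))) ^ n := fun t => by
      rw [mul_pow, ← Real.exp_nat_mul]; ring_nf
    calc ENNReal.ofReal (m ^ n) = ∫⁻ x, ENNReal.ofReal (Real.exp (z * ∑ i, X (x i))) ∂ν :=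
          (lintegral_exp_mul_sum hX (interior_subset hz) n).symm
      _ ≤ ∫⁻ x, (ENNReal.ofReal (Real.exp (n * (δ / 2))) *
              ENNReal.ofReal (min 1 (Real.exp (∑ i, X (x i))))
            + (ENNReal.ofReal (Real.exp (-(n * (δ / 2 * s)))) *
                ENNReal.ofReal (Real.exp ((z + s) * ∑ i, X (x i)))
              + ENNReal.ofReal (Real.exp (-(n * (δ / 2 * s)))) *
                ENNReal.ofReal (Real.exp ((z - s) * ∑ i, X (x i))))) ∂ν := by
          refine lintegral_mono fun x => ?_
          rw [← ENNReal.ofReal_mul (by positivity), ← ENNReal.ofReal_mul (by positivity),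
            ← ENNReal.ofReal_mul (by positivity), ← ENNReal.ofReal_add (by positivity)
            (by positivity), ← ENNReal.ofReal_add (by positivity) (by positivity)]
          exact ENNReal.ofReal_le_ofReal (hpt _)
      _ = _ := by
          rw [lintegral_add_left (by fun_prop), lintegral_add_left (by fun_prop),
            lintegral_const_mul _ (by fun_prop), lintegral_const_mul _ (by fun_prop),
            lintegral_const_mul _ (by fun_prop), lintegral_exp_mul_sum hX hs1,
            lintegral_exp_mul_sum hX hs2, ← hI, hIreal, ← ENNReal.ofReal_mul (by positivity),
            ← ENNReal.ofReal_mul (by positivity), ← ENNReal.ofReal_mul (by positivity), hq, hq,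
            ← ENNReal.ofReal_add (by positivity) (by positivity),
            ← ENNReal.ofReal_add (by positivity) (by positivity),
            ENNReal.toReal_ofReal (by positivity)]
  rw [hIreal]
  refine ENNReal.ofReal_le_ofReal ?_
  have hle' := (ENNReal.ofReal_le_ofReal_iff (by positivity)).1 hle
  have hmn : 0 < m ^ n := pow_pos hpos n
  have h5 : m ^ n / 2 ≤ Real.exp (n * (δ / 2)) * I.toReal := by linarith
  have h6 : Real.exp (-(n * δ)) = Real.exp (-(n * (δ / 2))) * Real.exp (-(n * (δ / 2))) := by
    rw [← Real.exp_add]; ring_nf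
  have h7 : Real.exp (-(n * (δ / 2))) * Real.exp (n * (δ / 2)) = 1 := by
    rw [← Real.exp_add]; simp
  calc Real.exp (-(n * δ)) * m ^ n
      ≤ Real.exp (-(n * (δ / 2))) * (1 / 2) * m ^ n := by rw [h6]; gcongr
    _ = Real.exp (-(n * (δ / 2))) * (m ^ n / 2) := by ring
    _ ≤ Real.exp (-(n * (δ / 2))) * (Real.exp (n * (δ / 2)) * I.toReal) := by gcongr
    _ = I.toReal := by rw [← mul_assoc, h7, one_mul]

lemma integrable_exp_mul_of_mem_Icc {l : Ω → ℝ} (hl : Integrable (fun y => Real.exp (l y)) P)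
    {z : ℝ} (hz : z ∈ Set.Icc (0 : ℝ) 1) :
    Integrable (fun y => Real.exp (z * l y)) P :=
  integrable_exp_mul_of_nonneg_of_le (u := 1) (by simpa using hl) hz.1 hz.2

lemma continuousOn_mgf_Icc {l : Ω → ℝ} (hlm : Measurable l)
    (hl : Integrable (fun y => Real.exp (l y)) P) :
    ContinuousOn (mgf l P) (Set.Icc 0 1) := by
  unfold mgf
  refine continuousOn_of_dominated (bound := fun y => 1 + Real.exp (l y)) ?_ ?_ ?_ ?_
  · intro z _
    exact (by fun_prop : Measurable fun y => Real.exp (z * l y)).aestronglyMeasurable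
  · intro z hz
    refine ae_of_all _ fun y => ?_
    rw [Real.norm_of_nonneg (Real.exp_pos _).le]
    rcases le_total 0 (l y) with h | h
    · have : Real.exp (z * l y) ≤ Real.exp (l y) :=
        Real.exp_le_exp.2 (mul_le_of_le_one_left h hz.2)
      linarith
    · have : Real.exp (z * l y) ≤ 1 := Real.exp_le_one_iff.2 (mul_nonpos_of_nonneg_of_nonpos hz.1 h)
      linarith [Real.exp_pos (l y)]
  · exact (integrable_const _).add hl
  · exact ae_of_all _ fun y => by fun_prop

/-- If the second-kind error of a sequence of tests of `P` against `Q` decays at least at rate `ρ`,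
where `e ^ (-ρ)` bounds the affinities `∫ (dQ/dP) ^ z dP` from below, then the first-kind error
decays at most at rate `ρ`. -/
lemma eventually_exp_le_of_eventually_compl_le [IsProbabilityMeasure Q] {l : Ω → ℝ}
    (hlm : Measurable l) (hQ : Q = P.withDensity fun y => ENNReal.ofReal (Real.exp (l y)))
    {ρ : ℝ} (hρ : ∀ z ∈ Set.Icc (0 : ℝ) 1, Real.exp (-ρ) ≤ mgf l P z)
    (hlt : ∃ z ∈ Set.Icc (0 : ℝ) 1, mgf l P z < 1) {C : ∀ n, Set (Fin n → Ω)}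
    (hC : ∀ ε > 0, ∀ᶠ n : ℕ in atTop, (Measure.pi fun _ : Fin n => Q) (C n)ᶜ ≤
      ENNReal.ofReal (Real.exp (-(n * (ρ - ε)))))
    {ε : ℝ} (hε : 0 < ε) :
    ∀ᶠ n : ℕ in atTop, ENNReal.ofReal (Real.exp (-(n * (ρ + ε)))) ≤
      (Measure.pi fun _ : Fin n => P) (C n) := by
  have hQ1 : ∫⁻ y, ENNReal.ofReal (Real.exp (l y)) ∂P = 1 := by
    have : Q Set.univ = 1 := measure_univ
    rwa [hQ, withDensity_apply _ MeasurableSet.univ, Measure.restrict_univ] at this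
  have hl : Integrable (fun y => Real.exp (l y)) P := by
    refine ⟨(by fun_prop : Measurable fun y => Real.exp (l y)).aestronglyMeasurable, ?_⟩
    rw [hasFiniteIntegral_iff_ofReal (ae_of_all _ fun _ => (Real.exp_pos _).le), hQ1]
    exact ENNReal.one_lt_top
  have hmgf1 : mgf l P 1 = 1 := by
    unfold mgf
    simp_rw [one_mul]
    rw [integral_eq_lintegral_of_nonneg_ae (ae_of_all _ fun _ => (Real.exp_pos _).le)
      hl.aestronglyMeasurable, hQ1, ENNReal.toReal_one]
  obtain ⟨z₁, hz₁, hz₁lt⟩ := hlt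
  have hM1pos : 0 < mgf l P z₁ := mgf_pos (integrable_exp_mul_of_mem_Icc hl hz₁)
  have hlog : 0 < -Real.log (mgf l P z₁) := by linarith [Real.log_neg hM1pos hz₁lt]
  obtain ⟨κ, hκ0, hκ⟩ := exists_between (lt_min (div_pos hε three_pos) hlog)
  have hκε : κ < ε / 3 := hκ.trans_le (min_le_left _ _)
  have hκM : κ < -Real.log (mgf l P z₁) := hκ.trans_le (min_le_right _ _)
  -- The shift discounts the second-kind error by `e ^ (-n κ)`, while it costs only `e ^ (-n z κ)`
  -- in the minimal moment generating function.
  set X : Ω → ℝ := fun y => l y - κ with hX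
  have hXm : Measurable X := hlm.sub_const κ
  have hexpX : ∀ z y, Real.exp (z * X y) = Real.exp (-(z * κ)) * Real.exp (z * l y) := by
    intro z y
    rw [← Real.exp_add, hX]; ring_nf
  have hmgfX : ∀ z, mgf X P z = Real.exp (-(z * κ)) * mgf l P z := fun z => by
    unfold mgf
    simp_rw [hexpX]
    rw [integral_const_mul]
  have hint : Set.Icc (0 : ℝ) 1 ⊆ integrableExpSet X P := fun z hz => by
    change Integrable (fun y => Real.exp (z * X y)) P
    simp_rw [hexpX]
    exact (integrable_exp_mul_of_mem_Icc hl hz).const_mul _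
  have hcont : ContinuousOn (mgf X P) (Set.Icc 0 1) := by
    have h1 : mgf X P = fun z => Real.exp (-(z * κ)) * mgf l P z := funext hmgfX
    rw [h1]
    exact ContinuousOn.mul (by fun_prop) (continuousOn_mgf_Icc hlm hl)
  obtain ⟨z, hz, hzmin⟩ := isCompact_Icc.exists_isMinOn (Set.nonempty_Icc.2 zero_le_one) hcont
  have hzκ : mgf X P z < Real.exp (-κ) := by
    refine (hzmin hz₁).trans_lt ?_
    rw [hmgfX]
    have h1 : mgf l P z₁ < Real.exp (-κ) := by
      rw [← Real.log_lt_iff_lt_exp hM1pos]; linarith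
    have h2 : Real.exp (-(z₁ * κ)) ≤ 1 := Real.exp_le_one_iff.2 (by nlinarith [hz₁.1])
    exact (mul_le_of_le_one_left hM1pos.le h2).trans_lt h1
  -- Neither endpoint is a minimizer: the values there are `1` and `e ^ (-κ)`, and `κ` is small
  -- enough for the value at `z₁` to be below both.
  have hz0 : z ≠ 0 := by
    rintro rfl
    rw [mgf_zero] at hzκ
    have : Real.exp (-κ) ≤ 1 := Real.exp_le_one_iff.2 (by linarith)
    linarith
  have hz1 : z ≠ 1 := by
    rintro rfl
    rw [hmgfX, hmgf1, one_mul, mul_one] at hzκ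
    exact lt_irrefl _ hzκ
  have hzI : z ∈ Set.Ioo (0 : ℝ) 1 := ⟨lt_of_le_of_ne hz.1 hz0.symm, lt_of_le_of_ne hz.2 hz1⟩
  have hzint : z ∈ interior (integrableExpSet X P) :=
    interior_mono hint (by rwa [interior_Icc])
  have hloc : IsLocalMin (mgf X P) z := hzmin.isLocalMin (Icc_mem_nhds hzI.1 hzI.2)
  have hgap : 0 < κ * (1 - z) := mul_pos hκ0 (by linarith [hzI.2])
  -- The two losses of size `δ` use up at most half of the gap `κ * (1 - z)`. The bound `δ ≤ κ < ε /
  -- 3` keeps the final rate below `ρ + ε`.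
  set δ : ℝ := min (κ * (1 - z) / 4) κ with hδ
  have hδ0 : 0 < δ := lt_min (by positivity) hκ0
  have hδgap : δ ≤ κ * (1 - z) / 4 := min_le_left _ _
  have hδκ : δ ≤ κ := min_le_right _ _
  filter_upwards [eventually_mgf_pow_le_lintegral_min hXm hzint hz hloc hδ0, hC δ hδ0,
    eventually_exp_neg_le (half_pos hgap) (show (0 : ℝ) < 1 / 2 by norm_num),
    eventually_exp_neg_le (div_pos hε three_pos) (show (0 : ℝ) < 1 / 2 by norm_num)]
    with n hn hCn hd1 hd2
  set ν := Measure.pi fun _ : Fin n => P with hν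
  -- The set `C n` is not assumed measurable. The hull `D` has the same `ν`-measure, and its
  -- complement is contained in that of `C n`.
  set D := toMeasurable ν (C n) with hD
  have hDm : MeasurableSet D := measurableSet_toMeasurable ν (C n)
  have hsplit : ∫⁻ x, ENNReal.ofReal (min 1 (Real.exp (∑ i, X (x i)))) ∂ν ≤
      ν (C n) + ENNReal.ofReal (Real.exp (-(n * κ))) * (Measure.pi fun _ : Fin n => Q) (C n)ᶜ := by
    rw [← lintegral_add_compl _ hDm]
    refine add_le_add ?_ ?_
    · calc ∫⁻ x in D, ENNReal.ofReal (min 1 (Real.exp (∑ i, X (x i)))) ∂ν ≤ ∫⁻ x in D, 1 ∂ν :=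
            lintegral_mono fun x => by
              rw [← ENNReal.ofReal_one]; exact ENNReal.ofReal_le_ofReal (min_le_left _ _)
        _ = ν (C n) := by rw [setLIntegral_one, hD, measure_toMeasurable]
    · have hQn : (Measure.pi fun _ : Fin n => Q) Dᶜ
          = ∫⁻ x in Dᶜ, ∏ i, ENNReal.ofReal (Real.exp (l (x i))) ∂ν := by
        subst hQ
        rw [pi_withDensity (by fun_prop), withDensity_apply _ hDm.compl]
      calc ∫⁻ x in Dᶜ, ENNReal.ofReal (min 1 (Real.exp (∑ i, X (x i)))) ∂ν
          ≤ ∫⁻ x in Dᶜ, ENNReal.ofReal (Real.exp (-(n * κ))) *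
              ∏ i, ENNReal.ofReal (Real.exp (l (x i))) ∂ν := by
            refine lintegral_mono fun x => ?_
            rw [← ENNReal.ofReal_prod_of_nonneg fun i _ => (Real.exp_pos _).le,
              ← ENNReal.ofReal_mul (Real.exp_pos _).le, ← Real.exp_sum, ← Real.exp_add]
            refine ENNReal.ofReal_le_ofReal ((min_le_right _ _).trans (le_of_eq ?_))
            simp only [hX, Finset.sum_sub_distrib, Finset.sum_const, Finset.card_univ,
              Fintype.card_fin, nsmul_eq_mul]
            ring_nf
        _ = ENNReal.ofReal (Real.exp (-(n * κ))) * (Measure.pi fun _ : Fin n => Q) Dᶜ := by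
            rw [lintegral_const_mul' _ _ ENNReal.ofReal_ne_top, hQn]
        _ ≤ _ := by
            gcongr
            exact subset_toMeasurable ν (C n)
  have hνreal : ν (C n) = ENNReal.ofReal (ν (C n)).toReal :=
    (ENNReal.ofReal_toReal (measure_ne_top ν _)).symm
  have htot : ENNReal.ofReal (Real.exp (-(n * δ)) * mgf X P z ^ n) ≤
      ENNReal.ofReal ((ν (C n)).toReal + Real.exp (-(n * κ)) * Real.exp (-(n * (ρ - δ)))) := by
    rw [ENNReal.ofReal_add (by positivity) (by positivity), ← hνreal,
      ENNReal.ofReal_mul (p := Real.exp (-(n * κ))) (by positivity)]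
    refine hn.trans (hsplit.trans ?_)
    gcongr
  have htot' := (ENNReal.ofReal_le_ofReal_iff (by positivity)).1 htot
  have hlow : Real.exp (-(n * (ρ + z * κ + δ))) ≤ Real.exp (-(n * δ)) * mgf X P z ^ n := by
    have h1 : Real.exp (-(z * κ + ρ)) ≤ mgf X P z := by
      rw [hmgfX, neg_add, Real.exp_add]
      exact mul_le_mul_of_nonneg_left (hρ z hz) (Real.exp_pos _).le
    calc Real.exp (-(n * (ρ + z * κ + δ)))
        = Real.exp (-(n * δ)) * Real.exp (-(z * κ + ρ)) ^ n := by
          rw [← Real.exp_nat_mul, ← Real.exp_add]; ring_nf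
      _ ≤ _ := by gcongr
  have hup : Real.exp (-(n * κ)) * Real.exp (-(n * (ρ - δ))) ≤
      1 / 2 * Real.exp (-(n * (ρ + z * κ + δ))) := by
    have hn0 : (0 : ℝ) ≤ n := Nat.cast_nonneg n
    calc Real.exp (-(n * κ)) * Real.exp (-(n * (ρ - δ)))
        ≤ Real.exp (-(n * (κ * (1 - z) / 2))) * Real.exp (-(n * (ρ + z * κ + δ))) := by
          rw [← Real.exp_add, ← Real.exp_add]
          refine Real.exp_le_exp.2 ?_
          nlinarith
      _ ≤ _ := by gcongr
  rw [hνreal]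
  refine ENNReal.ofReal_le_ofReal ?_
  calc Real.exp (-(n * (ρ + ε))) ≤ Real.exp (-(n * (ε / 3))) * Real.exp (-(n * (ρ + z * κ + δ))) := by
        have hn0 : (0 : ℝ) ≤ n := Nat.cast_nonneg n
        rw [← Real.exp_add]
        refine Real.exp_le_exp.2 ?_
        have : z * κ ≤ κ := mul_le_of_le_one_left hκ0.le hz.2
        nlinarith
    _ ≤ 1 / 2 * Real.exp (-(n * (ρ + z * κ + δ))) := by gcongr
    _ ≤ (ν (C n)).toReal := by linarith

end Sampling

/-! ### The Chernoff index of a pair of densities -/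

section Pair

open ProbabilityTheory

variable {μ : Measure ℝ} {f g h : ℝ → ℝ}

lemma IsDensity.isProbabilityMeasure (hf : IsDensity μ f) : IsProbabilityMeasure (law μ f) :=
  ⟨by rw [law, withDensity_apply _ MeasurableSet.univ, Measure.restrict_univ, hf.lintegral_eq_one]⟩

lemma IsDensity.ae_pos (hf : IsDensity μ f) : ∀ᵐ x ∂(law μ f), 0 < f x := by
  rw [law, ae_withDensity_iff hf.measurable.ennreal_ofReal]
  exact ae_of_all _ fun x hx => by simpa using hx

lemma measurable_logLR (hg : Measurable g) (hh : Measurable h) : Measurable (logLR g h) :=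
  (Real.measurable_log.comp hh).sub (Real.measurable_log.comp hg)

lemma logLR_swap (x : ℝ) : logLR h g x = -logLR g h x := by simp [logLR]

/-- Where `g` is positive, `h` is positive too and the exponential is `h / g`; where `g` vanishes so
does `h`, so the convention `log 0 = 0` does no harm. Both hold `μ`-almost everywhere by mutual
absolute continuity. -/
lemma law_eq_withDensity (hg : IsDensity μ g) (hh : IsDensity μ h)
    (hgh : law μ g ≪ law μ h) (hhg : law μ h ≪ law μ g) :
    law μ h = (law μ g).withDensity fun x => ENNReal.ofReal (Real.exp (logLR g h x)) := by
  have hm : Measurable fun x => ENNReal.ofReal (Real.exp (logLR g h x)) :=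
    (Real.measurable_exp.comp (measurable_logLR hg.measurable hh.measurable)).ennreal_ofReal
  rw [law, law, ← withDensity_mul _ hg.measurable.ennreal_ofReal hm]
  refine withDensity_congr_ae ?_
  have h1 := (ae_withDensity_iff hg.measurable.ennreal_ofReal).1 (hgh.ae_le hh.ae_pos)
  have h2 := (ae_withDensity_iff hh.measurable.ennreal_ofReal).1 (hhg.ae_le hg.ae_pos)
  filter_upwards [h1, h2] with x hx1 hx2
  rw [Pi.mul_apply, ← ENNReal.ofReal_mul (hg.nonneg x)]
  rcases (hg.nonneg x).eq_or_lt with h0 | h0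
  · rw [← h0, zero_mul, ENNReal.ofReal_zero]
    by_contra hne
    exact lt_irrefl _ ((hx2 hne).trans_eq h0.symm)
  · have hhpos : 0 < h x := hx1 (by simpa using h0)
    rw [logLR, Real.exp_sub, Real.exp_log hhpos, Real.exp_log h0, mul_div_cancel₀ _ h0.ne']

lemma lintegral_law_eq (hg : IsDensity μ g) (hh : IsDensity μ h)
    (hgh : law μ g ≪ law μ h) (hhg : law μ h ≪ law μ g) {k : ℝ → ℝ≥0∞} (hk : Measurable k) :
    ∫⁻ x, k x ∂(law μ h) = ∫⁻ x, ENNReal.ofReal (Real.exp (logLR g h x)) * k x ∂(law μ g) := by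
  rw [law_eq_withDensity hg hh hgh hhg, lintegral_withDensity_eq_lintegral_mul _ _ hk]
  · rfl
  · exact (Real.measurable_exp.comp (measurable_logLR hg.measurable hh.measurable)).ennreal_ofReal

lemma lintegral_exp_logLR (hg : IsDensity μ g) (hh : IsDensity μ h)
    (hgh : law μ g ≪ law μ h) (hhg : law μ h ≪ law μ g) :
    ∫⁻ x, ENNReal.ofReal (Real.exp (logLR g h x)) ∂(law μ g) = 1 := by
  have h1 := lintegral_law_eq hg hh hgh hhg (k := fun _ => 1) measurable_const
  have := hh.isProbabilityMeasure
  simpa using h1.symm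

lemma integrable_exp_logLR (hg : IsDensity μ g) (hh : IsDensity μ h)
    (hgh : law μ g ≪ law μ h) (hhg : law μ h ≪ law μ g) :
    Integrable (fun x => Real.exp (logLR g h x)) (law μ g) := by
  refine ⟨(Real.measurable_exp.comp
    (measurable_logLR hg.measurable hh.measurable)).aestronglyMeasurable, ?_⟩
  rw [hasFiniteIntegral_iff_ofReal (ae_of_all _ fun _ => (Real.exp_pos _).le),
    lintegral_exp_logLR hg hh hgh hhg]
  exact ENNReal.one_lt_top

lemma mgfLR_eq_lintegral_exp (hg : IsDensity μ g) (hh : IsDensity μ h)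
    (hgh : law μ g ≪ law μ h) (z : ℝ) :
    mgfLR μ g h z = ∫⁻ x, ENNReal.ofReal (Real.exp (z * logLR g h x)) ∂(law μ g) := by
  refine lintegral_congr_ae ?_
  filter_upwards [hg.ae_pos, hgh.ae_le hh.ae_pos] with x hx1 hx2
  rw [Real.rpow_def_of_pos (div_pos hx2 hx1), Real.log_div hx2.ne' hx1.ne', logLR, mul_comm]

lemma mgfLR_eq_ofReal_mgf (hg : IsDensity μ g) (hh : IsDensity μ h)
    (hgh : law μ g ≪ law μ h) (hhg : law μ h ≪ law μ g) {z : ℝ} (hz : z ∈ Set.Icc (0 : ℝ) 1) :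
    mgfLR μ g h z = ENNReal.ofReal (mgf (logLR g h) (law μ g) z) := by
  have := hg.isProbabilityMeasure
  rw [mgfLR_eq_lintegral_exp hg hh hgh, mgf, ofReal_integral_eq_lintegral_ofReal
    (integrable_exp_mul_of_mem_Icc (integrable_exp_logLR hg hh hgh hhg) hz)
    (ae_of_all _ fun _ => (Real.exp_pos _).le)]

/-- Passing from `law μ h` to `law μ g` contributes a factor `e ^ l`, and exchanging the densities
changes the sign of `l`. -/
lemma mgfLR_swap (hg : IsDensity μ g) (hh : IsDensity μ h)
    (hgh : law μ g ≪ law μ h) (hhg : law μ h ≪ law μ g) (z : ℝ) :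
    mgfLR μ h g z = mgfLR μ g h (1 - z) := by
  rw [mgfLR_eq_lintegral_exp hh hg hhg, mgfLR_eq_lintegral_exp hg hh hgh,
    lintegral_law_eq hg hh hgh hhg (k := fun x => ENNReal.ofReal (Real.exp (z * logLR h g x)))
      (Real.measurable_exp.comp ((measurable_logLR hh.measurable hg.measurable).const_mul
        z)).ennreal_ofReal]
  refine lintegral_congr fun x => ?_
  rw [← ENNReal.ofReal_mul (Real.exp_pos _).le, ← Real.exp_add, logLR_swap]
  ring_nf

lemma mgfLR_zero (hg : IsDensity μ g) : mgfLR μ g h 0 = 1 := by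
  have := hg.isProbabilityMeasure
  simp [mgfLR]

lemma lintegral_logLR_pos_le_one (hg : IsDensity μ g) (hh : IsDensity μ h)
    (hgh : law μ g ≪ law μ h) (hhg : law μ h ≪ law μ g) :
    ∫⁻ x, ENNReal.ofReal (logLR g h x) ∂(law μ g) ≤ 1 := by
  rw [← lintegral_exp_logLR hg hh hgh hhg]
  refine lintegral_mono fun x => ENNReal.ofReal_le_ofReal ?_
  linarith [Real.add_one_le_exp (logLR g h x)]

/-- Outside the unit interval and beyond the mean, the terms of the rate function are
nonpositive. -/
lemma rateFun_le_iSup (hg : IsDensity μ g) (hh : IsDensity μ h)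
    (hgh : law μ g ≪ law μ h) (hhg : law μ h ≪ law μ g) {t : ℝ} (ht : t ≤ 0)
    (hE : expectation (law μ g) (logLR g h) < (t : EReal)) :
    rateFun μ g h t ≤ ⨆ z : Set.Icc (0 : ℝ) 1, -ENNReal.log (mgfLR μ g h z) := by
  have hP := hg.isProbabilityMeasure
  have hm := measurable_logLR hg.measurable hh.measurable
  have hterm : ∀ z ∈ Set.Icc (0 : ℝ) 1, -ENNReal.log (mgfLR μ g h z) ≤
      ⨆ z : Set.Icc (0 : ℝ) 1, -ENNReal.log (mgfLR μ g h z) := fun z hz =>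
    le_iSup (fun z : Set.Icc (0 : ℝ) 1 => -ENNReal.log (mgfLR μ g h z)) ⟨z, hz⟩
  have hnonneg : 0 ≤ ⨆ z : Set.Icc (0 : ℝ) 1, -ENNReal.log (mgfLR μ g h z) := by
    refine le_trans ?_ (hterm 0 (by simp))
    simp [mgfLR_zero hg]
  -- For `z` outside `[0, 1]` it is enough to show `M(z) ≥ e ^ (z t)`.
  have hlow : ∀ z : ℝ, ENNReal.ofReal (Real.exp (z * t)) ≤ mgfLR μ g h z →
      ((z * t : ℝ) : EReal) - ENNReal.log (mgfLR μ g h z) ≤ 0 := by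
    intro z hz
    have h1 := ENNReal.log_le_log hz
    rw [ENNReal.log_ofReal_of_pos (Real.exp_pos _), Real.log_exp] at h1
    exact EReal.sub_nonpos.2 h1
  refine iSup_le fun z => ?_
  rcases lt_or_ge z 0 with hz | hz
  · refine le_trans (hlow z ?_) hnonneg
    set Lp := ∫⁻ x, ENNReal.ofReal (logLR g h x) ∂(law μ g) with hLp
    set Lm := ∫⁻ x, ENNReal.ofReal (-logLR g h x) ∂(law μ g) with hLm
    have hLpfin : Lp ≠ ∞ :=
      ((lintegral_logLR_pos_le_one hg hh hgh hhg).trans_lt ENNReal.one_lt_top).ne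
    -- This is `E_g l ≤ t` in a subtraction-free form that also covers `E_g l = -∞`.
    have hle : Lp + ENNReal.ofReal (-t) ≤ Lm := by
      by_cases hLmfin : Lm = ∞
      · simp [hLmfin]
      unfold expectation at hE
      rw [← hLp, ← hLm, ← ENNReal.ofReal_toReal hLpfin, ← ENNReal.ofReal_toReal hLmfin,
        EReal.coe_ennreal_ofReal, EReal.coe_ennreal_ofReal, max_eq_left ENNReal.toReal_nonneg,
        max_eq_left ENNReal.toReal_nonneg] at hE
      have hE' : Lp.toReal - Lm.toReal < t := by exact_mod_cast hE
      rw [← ENNReal.ofReal_toReal hLpfin, ← ENNReal.ofReal_toReal hLmfin,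
        ← ENNReal.ofReal_add ENNReal.toReal_nonneg (by linarith)]
      exact ENNReal.ofReal_le_ofReal (by linarith)
    -- Jensen's inequality through the tangent line, `e ^ (z (y - t)) ≥ 1 + z (y - t)`, with
    -- negative terms moved across so that everything lives in `[0, ∞]`.
    have hpt : ∀ x, 1 + ENNReal.ofReal (-z) * ENNReal.ofReal (-logLR g h x) ≤
        ENNReal.ofReal (Real.exp (-(z * t))) * ENNReal.ofReal (Real.exp (z * logLR g h x))
          + ENNReal.ofReal (-z) * (ENNReal.ofReal (logLR g h x) + ENNReal.ofReal (-t)) := by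
      intro x
      set y := logLR g h x
      have key := Real.add_one_le_exp (z * y - z * t)
      have e1 : Real.exp (z * y - z * t) = Real.exp (-(z * t)) * Real.exp (z * y) := by
        rw [← Real.exp_add]; ring_nf
      rw [e1] at key
      rw [← ENNReal.ofReal_mul (Real.exp_pos _).le]
      rcases le_total 0 y with hy | hy
      · rw [ENNReal.ofReal_of_nonpos (neg_nonpos.2 hy), mul_zero, add_zero,
          ← ENNReal.ofReal_add hy (by linarith), ← ENNReal.ofReal_mul (by linarith),
          ← ENNReal.ofReal_add (by positivity) (by nlinarith), ← ENNReal.ofReal_one]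
        refine ENNReal.ofReal_le_ofReal ?_
        nlinarith
      · rw [ENNReal.ofReal_of_nonpos hy, zero_add, ← ENNReal.ofReal_mul (by linarith),
          ← ENNReal.ofReal_mul (by linarith), ← ENNReal.ofReal_add (by positivity) (by nlinarith),
          ← ENNReal.ofReal_one, ← ENNReal.ofReal_add zero_le_one (by nlinarith)]
        refine ENNReal.ofReal_le_ofReal ?_
        nlinarith
    have hint := lintegral_mono (μ := law μ g) hpt
    rw [lintegral_add_left measurable_const, lintegral_const_mul _ (by fun_prop),
      lintegral_add_left (by fun_prop), lintegral_const_mul _ (by fun_prop),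
      lintegral_const_mul _ (by fun_prop), lintegral_add_left (by fun_prop),
      ← mgfLR_eq_lintegral_exp hg hh hgh, ← hLp, ← hLm] at hint
    simp only [lintegral_const, measure_univ, mul_one] at hint
    have hint2 : 1 + ENNReal.ofReal (-z) * (Lp + ENNReal.ofReal (-t)) ≤
        ENNReal.ofReal (Real.exp (-(z * t))) * mgfLR μ g h z
          + ENNReal.ofReal (-z) * (Lp + ENNReal.ofReal (-t)) := by
      refine le_trans ?_ hint
      gcongr
    have hfin : ENNReal.ofReal (-z) * (Lp + ENNReal.ofReal (-t)) ≠ ∞ :=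
      ENNReal.mul_ne_top ENNReal.ofReal_ne_top (ENNReal.add_ne_top.2 ⟨hLpfin, ENNReal.ofReal_ne_top⟩)
    have h1 := (ENNReal.add_le_add_iff_right hfin).1 hint2
    calc ENNReal.ofReal (Real.exp (z * t)) = ENNReal.ofReal (Real.exp (z * t)) * 1 := (mul_one _).symm
      _ ≤ ENNReal.ofReal (Real.exp (z * t)) *
          (ENNReal.ofReal (Real.exp (-(z * t))) * mgfLR μ g h z) := by gcongr
      _ = mgfLR μ g h z := by
        rw [← mul_assoc, ← ENNReal.ofReal_mul (Real.exp_pos _).le, ← Real.exp_add]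
        simp
  rcases le_or_gt z 1 with hz1 | hz1
  · refine le_trans ?_ (hterm z ⟨hz, hz1⟩)
    rw [sub_eq_add_neg]
    refine add_le_of_nonpos_left ?_
    exact_mod_cast mul_nonpos_of_nonneg_of_nonpos hz ht
  · refine le_trans (hlow z ?_) hnonneg
    -- Bernoulli's inequality gives `(e ^ l) ^ z ≥ 1 + z (e ^ l - 1)`, and `e ^ l` has mean one.
    have hM : 1 ≤ mgfLR μ g h z := by
      have hpt : ∀ x, ENNReal.ofReal z * ENNReal.ofReal (Real.exp (logLR g h x)) ≤
          ENNReal.ofReal (Real.exp (z * logLR g h x)) + ENNReal.ofReal (z - 1) := by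
        intro x
        have h1 := one_add_mul_self_le_rpow_one_add (s := Real.exp (logLR g h x) - 1)
          (by linarith [Real.exp_pos (logLR g h x)]) hz1.le
        rw [add_sub_cancel, ← Real.exp_mul, mul_comm (logLR g h x)] at h1
        rw [← ENNReal.ofReal_mul hz, ← ENNReal.ofReal_add (Real.exp_pos _).le (by linarith)]
        exact ENNReal.ofReal_le_ofReal (by linarith)
      have hint := lintegral_mono (μ := law μ g) hpt
      rw [lintegral_const_mul _ (by fun_prop), lintegral_add_left (by fun_prop),
        ← mgfLR_eq_lintegral_exp hg hh hgh, lintegral_exp_logLR hg hh hgh hhg] at hint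
      simp only [lintegral_const, measure_univ, mul_one] at hint
      have e : ENNReal.ofReal z = 1 + ENNReal.ofReal (z - 1) := by
        rw [← ENNReal.ofReal_one, ← ENNReal.ofReal_add zero_le_one (by linarith)]; ring_nf
      rw [e] at hint
      exact (ENNReal.add_le_add_iff_right ENNReal.ofReal_ne_top).1 hint
    refine le_trans ?_ hM
    rw [← ENNReal.ofReal_one]
    exact ENNReal.ofReal_le_ofReal
      (Real.exp_le_one_iff.2 (mul_nonpos_of_nonneg_of_nonpos hz ht))

lemma expectation_logLR_swap (hg : IsDensity μ g) (hh : IsDensity μ h)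
    (hgh : law μ g ≪ law μ h) (hhg : law μ h ≪ law μ g) :
    expectation (law μ g) (logLR h g) = -expectation (law μ g) (logLR g h) := by
  have hfin : (((∫⁻ x, ENNReal.ofReal (logLR g h x) ∂(law μ g) : ℝ≥0∞)) : EReal) ≠ ⊤ := by
    rw [Ne, EReal.coe_ennreal_eq_top_iff]
    exact ((lintegral_logLR_pos_le_one hg hh hgh hhg).trans_lt ENNReal.one_lt_top).ne
  unfold expectation
  simp_rw [logLR_swap (g := g) (h := h), neg_neg]
  rw [EReal.neg_sub (Or.inl (EReal.coe_ennreal_ne_bot _)) (Or.inl hfin), sub_eq_add_neg, add_comm]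

/-- The information inequality. -/
lemma expectation_logLR_neg (hg : IsDensity μ g) (hh : IsDensity μ h)
    (hgh : law μ g ≪ law μ h) (hhg : law μ h ≪ law μ g)
    (hne : ¬ ∀ᵐ x ∂(law μ g), logLR g h x = 0) :
    expectation (law μ g) (logLR g h) < 0 := by
  have hP := hg.isProbabilityMeasure
  have hm := measurable_logLR hg.measurable hh.measurable
  set Lp := ∫⁻ x, ENNReal.ofReal (logLR g h x) ∂(law μ g) with hLp
  set Lm := ∫⁻ x, ENNReal.ofReal (-logLR g h x) ∂(law μ g) with hLm
  have hLpfin : Lp ≠ ∞ :=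
    ((lintegral_logLR_pos_le_one hg hh hgh hhg).trans_lt ENNReal.one_lt_top).ne
  set W := ∫⁻ x, ENNReal.ofReal (Real.exp (logLR g h x) - 1 - logLR g h x) ∂(law μ g) with hW
  -- As `E_g e ^ l = 1`, the mean of `-l` equals that of `e ^ l - 1 - l`, which is nonnegative and
  -- vanishes only at `l = 0`.
  have hsum : 1 + Lm = 1 + (Lp + W) := by
    have hpt : ∀ x, ENNReal.ofReal (Real.exp (logLR g h x)) + ENNReal.ofReal (-logLR g h x)
        = 1 + (ENNReal.ofReal (logLR g h x)
          + ENNReal.ofReal (Real.exp (logLR g h x) - 1 - logLR g h x)) := by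
      intro x
      set y := logLR g h x
      have h1 := Real.add_one_le_exp y
      rcases le_total 0 y with hy | hy
      · rw [ENNReal.ofReal_of_nonpos (neg_nonpos.2 hy), add_zero,
          ← ENNReal.ofReal_add hy (by linarith), ← ENNReal.ofReal_one,
          ← ENNReal.ofReal_add zero_le_one (by linarith)]
        ring_nf
      · rw [ENNReal.ofReal_of_nonpos hy, zero_add, ← ENNReal.ofReal_one,
          ← ENNReal.ofReal_add zero_le_one (by linarith),
          ← ENNReal.ofReal_add (Real.exp_pos _).le (by linarith)]
        ring_nf
    have h1 := lintegral_congr (μ := law μ g) hpt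
    rw [lintegral_add_left (by fun_prop), lintegral_add_left measurable_const,
      lintegral_add_left (by fun_prop), lintegral_exp_logLR hg hh hgh hhg] at h1
    simpa using h1
  have hLm_eq : Lm = Lp + W := (ENNReal.add_right_inj ENNReal.one_ne_top).1 hsum
  have hWpos : W ≠ 0 := by
    intro h0
    rw [hW, lintegral_eq_zero_iff (by fun_prop)] at h0
    refine hne ?_
    filter_upwards [h0] with x hx
    by_contra hx0
    have h1 := Real.add_one_lt_exp hx0
    simp only [Pi.zero_apply, ENNReal.ofReal_eq_zero] at hx
    linarith
  have hlt : Lp < Lm := by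
    rw [hLm_eq]; exact ENNReal.lt_add_right hLpfin hWpos
  unfold expectation
  rw [← hLp, ← hLm]
  rw [EReal.sub_neg (Or.inl (by simpa using hLpfin)) (Or.inl (EReal.coe_ennreal_ne_bot _))]
  exact_mod_cast hlt

/-- For `t ≤ 0` the first rate function is already at most the right side, for `t ≥ 0` the second
one is. Conversely `t = 0` is admissible by the information inequality, and there both rate
functions dominate each `-log M(z)`, the second through the symmetry `z ↦ 1 - z`. -/
lemma chernoffIndex_eq_iSup (hg : IsDensity μ g) (hh : IsDensity μ h)
    (hgh : law μ g ≪ law μ h) (hhg : law μ h ≪ law μ g)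
    (hne : ¬ ∀ᵐ x ∂(law μ g), logLR g h x = 0) :
    chernoffIndex μ g h = ⨆ z : Set.Icc (0 : ℝ) 1, -ENNReal.log (mgfLR μ g h z) := by
  have hne' : ¬ ∀ᵐ x ∂(law μ h), logLR h g x = 0 := fun hcon => hne <| by
    filter_upwards [hgh.ae_le hcon] with x hx
    rwa [logLR_swap, neg_eq_zero] at hx
  have hEg := expectation_logLR_neg hg hh hgh hhg hne
  have hEh : 0 < expectation (law μ h) (logLR g h) := by
    rw [expectation_logLR_swap hh hg hhg hgh]
    have := expectation_logLR_neg hh hg hhg hgh hne'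
    rwa [← EReal.neg_lt_neg_iff, neg_zero] at this
  apply le_antisymm
  · refine iSup₂_le fun t ht => ?_
    rcases le_total t 0 with h0 | h0
    · exact (min_le_left _ _).trans (rateFun_le_iSup hg hh hgh hhg h0 ht.1)
    · refine (min_le_right _ _).trans ((rateFun_le_iSup hh hg hhg hgh (neg_nonpos.2 h0) ?_).trans ?_)
      · rw [← EReal.neg_lt_neg_iff, ← expectation_logLR_swap hh hg hhg hgh, EReal.coe_neg, neg_neg]
        exact ht.2
      · refine iSup_le fun z => ?_
        rw [mgfLR_swap hg hh hgh hhg]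
        exact le_iSup (fun z : Set.Icc (0 : ℝ) 1 => -ENNReal.log (mgfLR μ g h z))
          ⟨1 - z, by linarith [z.2.2], by linarith [z.2.1]⟩
  · refine iSup_le fun z => le_iSup₂_of_le 0 ⟨by simpa using hEg, by simpa using hEh⟩ (le_min ?_ ?_)
    · refine le_iSup_of_le (z : ℝ) ?_
      simp
    · refine le_iSup_of_le (1 - z : ℝ) ?_
      rw [mgfLR_swap hg hh hgh hhg]
      simp

/-- The supremum of `-log M(z)` over the unit interval is attained. -/
lemma exists_chernoffIndex_eq_neg_log (hg : IsDensity μ g) (hh : IsDensity μ h)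
    (hgh : law μ g ≪ law μ h) (hhg : law μ h ≪ law μ g)
    (hne : ¬ ∀ᵐ x ∂(law μ g), logLR g h x = 0) :
    ∃ z ∈ Set.Icc (0 : ℝ) 1, 0 < mgf (logLR g h) (law μ g) z ∧
      (∀ z' ∈ Set.Icc (0 : ℝ) 1, mgf (logLR g h) (law μ g) z ≤ mgf (logLR g h) (law μ g) z') ∧
      chernoffIndex μ g h = ((-Real.log (mgf (logLR g h) (law μ g) z) : ℝ) : EReal) := by
  have hP := hg.isProbabilityMeasure
  have hint := integrable_exp_logLR hg hh hgh hhg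
  obtain ⟨z, hz, hzmin⟩ := isCompact_Icc.exists_isMinOn (Set.nonempty_Icc.2 zero_le_one)
    (continuousOn_mgf_Icc (measurable_logLR hg.measurable hh.measurable) hint)
  have hpos : ∀ z' ∈ Set.Icc (0 : ℝ) 1, 0 < mgf (logLR g h) (law μ g) z' := fun z' hz' =>
    mgf_pos (integrable_exp_mul_of_mem_Icc hint hz')
  have hlog : ∀ z' ∈ Set.Icc (0 : ℝ) 1, -ENNReal.log (mgfLR μ g h z')
      = ((-Real.log (mgf (logLR g h) (law μ g) z') : ℝ) : EReal) := fun z' hz' => by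
    rw [mgfLR_eq_ofReal_mgf hg hh hgh hhg hz', ENNReal.log_ofReal_of_pos (hpos z' hz'),
      EReal.coe_neg]
  refine ⟨z, hz, hpos z hz, fun z' hz' => hzmin hz', ?_⟩
  rw [chernoffIndex_eq_iSup hg hh hgh hhg hne]
  apply le_antisymm
  · refine iSup_le fun z' => ?_
    rw [hlog z' z'.2, EReal.coe_le_coe_iff]
    exact neg_le_neg (Real.log_le_log (hpos z hz) (hzmin z'.2))
  · rw [← hlog z hz]
    exact le_iSup (fun z : Set.Icc (0 : ℝ) 1 => -ENNReal.log (mgfLR μ g h z)) ⟨z, hz⟩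

/-- The Hellinger affinity of distinct distributions is less than one. -/
lemma mgf_half_lt_one (hg : IsDensity μ g) (hh : IsDensity μ h)
    (hgh : law μ g ≪ law μ h) (hhg : law μ h ≪ law μ g)
    (hne : ¬ ∀ᵐ x ∂(law μ g), logLR g h x = 0) :
    mgf (logLR g h) (law μ g) (1 / 2) < 1 := by
  have hP := hg.isProbabilityMeasure
  have hint := integrable_exp_logLR hg hh hgh hhg
  have hint2 : Integrable (fun x => Real.exp (1 / 2 * logLR g h x)) (law μ g) :=
    integrable_exp_mul_of_mem_Icc hint ⟨by norm_num, by norm_num⟩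
  have h1 : ∫ x, Real.exp (logLR g h x) ∂(law μ g) = 1 := by
    rw [integral_eq_lintegral_of_nonneg_ae (ae_of_all _ fun _ => (Real.exp_pos _).le)
      hint.aestronglyMeasurable, lintegral_exp_logLR hg hh hgh hhg, ENNReal.toReal_one]
  have hsq : ∀ x, (Real.exp (1 / 2 * logLR g h x) - 1) ^ 2
      = Real.exp (logLR g h x) - 2 * Real.exp (1 / 2 * logLR g h x) + 1 := fun x => by
    have : Real.exp (logLR g h x) = Real.exp (1 / 2 * logLR g h x) ^ 2 := by
      rw [← Real.exp_nat_mul]; ring_nf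
    rw [this]; ring
  have hintsq : Integrable (fun x => (Real.exp (1 / 2 * logLR g h x) - 1) ^ 2) (law μ g) := by
    simp_rw [hsq]
    exact (hint.sub (hint2.const_mul 2)).add (integrable_const 1)
  have hval : ∫ x, (Real.exp (1 / 2 * logLR g h x) - 1) ^ 2 ∂(law μ g)
      = 2 - 2 * mgf (logLR g h) (law μ g) (1 / 2) := by
    simp_rw [hsq]
    rw [integral_add (f := fun x => Real.exp (logLR g h x) - 2 * Real.exp (1 / 2 * logLR g h x))
      (hint.sub (hint2.const_mul 2)) (integrable_const 1), integral_sub hint (hint2.const_mul 2),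
      integral_const_mul, h1]
    simp only [integral_const, probReal_univ, smul_eq_mul, mul_one, mgf]
    ring
  have hnn : 0 ≤ ∫ x, (Real.exp (1 / 2 * logLR g h x) - 1) ^ 2 ∂(law μ g) :=
    integral_nonneg fun x => sq_nonneg _
  rcases hnn.eq_or_lt with h0 | h0
  · exfalso
    refine hne ?_
    rw [eq_comm, integral_eq_zero_iff_of_nonneg (fun x => sq_nonneg _) hintsq] at h0
    filter_upwards [h0] with x hx
    have h2 : Real.exp (1 / 2 * logLR g h x) = 1 := by
      have := pow_eq_zero_iff two_ne_zero |>.1 (show (Real.exp (1 / 2 * logLR g h x) - 1) ^ 2 = 0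
        from hx)
      linarith
    rw [Real.exp_eq_one_iff] at h2
    linarith
  · linarith

end Pair

/-! ### Lower semicontinuity of the index and existence of the minimum -/

section Minimum

variable {dg dh : ℕ} {μ : Measure ℝ} {Θ : Set (EuclideanSpace ℝ (Fin dg))}
  {Γ : Set (EuclideanSpace ℝ (Fin dh))} {g : EuclideanSpace ℝ (Fin dg) → ℝ → ℝ}
  {h : EuclideanSpace ℝ (Fin dh) → ℝ → ℝ}

/-- The deficit in the weighted arithmetic-geometric mean inequality for `e ^ a` and `e ^ b`. -/
noncomputable def meanGap (z a b : ℝ) : ℝ :=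
  z * Real.exp b + (1 - z) * Real.exp a - Real.exp (z * b + (1 - z) * a)

lemma meanGap_nonneg {z : ℝ} (hz : z ∈ Set.Icc (0 : ℝ) 1) (a b : ℝ) : 0 ≤ meanGap z a b := by
  have := convexOn_exp.2 (Set.mem_univ b) (Set.mem_univ a) hz.1 (sub_nonneg.2 hz.2) (by ring)
  simp only [smul_eq_mul] at this
  unfold meanGap
  linarith

/-- Both likelihood ratios against `f` have mean one, so their weighted arithmetic mean integrates
to one and the geometric mean to `M(z)`. Fatou's lemma applied to `M` itself would bound it from the
wrong side; applied to the gap it gives upper semicontinuity of `M`. -/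
lemma mgfLR_add_lintegral_meanGap {f g h : ℝ → ℝ} (hf : IsDensity μ f) (hg : IsDensity μ g)
    (hh : IsDensity μ h) (hfg : law μ f ≪ law μ g) (hgf : law μ g ≪ law μ f)
    (hfh : law μ f ≪ law μ h) (hhf : law μ h ≪ law μ f) {z : ℝ} (hz : z ∈ Set.Icc (0 : ℝ) 1) :
    mgfLR μ g h z
      + ∫⁻ x, ENNReal.ofReal (meanGap z (logLR f g x) (logLR f h x)) ∂(law μ f) = 1 := by
  have hP := hf.isProbabilityMeasure
  have hm1 := measurable_logLR hf.measurable hg.measurable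
  have hm2 := measurable_logLR hf.measurable hh.measurable
  have hm3 := measurable_logLR hg.measurable hh.measurable
  have h1z : 0 ≤ 1 - z := sub_nonneg.2 hz.2
  rw [mgfLR_eq_lintegral_exp hg hh (hgf.trans hfh), lintegral_law_eq hf hg hfg hgf (by fun_prop),
    ← lintegral_add_left (by fun_prop)]
  have hpt : ∀ x, ENNReal.ofReal (Real.exp (logLR f g x)) *
        ENNReal.ofReal (Real.exp (z * logLR g h x))
        + ENNReal.ofReal (meanGap z (logLR f g x) (logLR f h x))
      = ENNReal.ofReal z * ENNReal.ofReal (Real.exp (logLR f h x))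
        + ENNReal.ofReal (1 - z) * ENNReal.ofReal (Real.exp (logLR f g x)) := by
    intro x
    rw [← ENNReal.ofReal_mul (Real.exp_pos _).le, ← ENNReal.ofReal_mul hz.1,
      ← ENNReal.ofReal_mul h1z, ← ENNReal.ofReal_add (by positivity) (meanGap_nonneg hz _ _),
      ← ENNReal.ofReal_add (mul_nonneg hz.1 (Real.exp_pos _).le)
        (mul_nonneg h1z (Real.exp_pos _).le), ← Real.exp_add]
    congr 1
    have e : logLR f g x + z * logLR g h x = z * logLR f h x + (1 - z) * logLR f g x := by
      unfold logLR; ring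
    rw [e, meanGap]
    ring
  simp_rw [hpt]
  rw [lintegral_add_left (by fun_prop), lintegral_const_mul _ (by fun_prop),
    lintegral_const_mul _ (by fun_prop), lintegral_exp_logLR hf hh hfh hhf,
    lintegral_exp_logLR hf hg hfg hgf, mul_one, mul_one, ← ENNReal.ofReal_add hz.1 h1z]
  simp

/-- Fatou's lemma for a continuous parameter. -/
lemma lowerSemicontinuous_lintegral {ι Ω : Type*} [TopologicalSpace ι] [FirstCountableTopology ι]
    [MeasurableSpace Ω] {P : Measure Ω} {F : ι → Ω → ℝ≥0∞} (hF : ∀ p, Measurable (F p))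
    (hcont : ∀ᵐ x ∂P, Continuous fun p => F p x) :
    LowerSemicontinuous fun p => ∫⁻ x, F p x ∂P := by
  rw [lowerSemicontinuous_iff_le_liminf]
  intro p
  refine le_trans (lintegral_mono_ae ?_) (lintegral_liminf_le hF)
  filter_upwards [hcont] with x hx
  exact (hx.tendsto p).liminf_eq.ge

lemma lowerSemicontinuous_lintegral_meanGap
    (hg : ∀ θ ∈ Θ, IsDensity μ (g θ)) (hh : ∀ γ ∈ Γ, IsDensity μ (h γ))
    (hac : MutuallyAC μ Θ Γ g h)
    (hg_diff : LogDifferentiable μ Θ g) (hh_diff : LogDifferentiable μ Γ h)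
    {θ₀ : EuclideanSpace ℝ (Fin dg)} (hθ₀ : θ₀ ∈ Θ) (z : ℝ) :
    LowerSemicontinuous fun p : Θ × Γ =>
      ∫⁻ x, ENNReal.ofReal (meanGap z (logLR (g θ₀) (g p.1) x) (logLR (g θ₀) (h p.2) x))
        ∂(law μ (g θ₀)) := by
  rcases Γ.eq_empty_or_nonempty with rfl | ⟨γ₀, hγ₀⟩
  · exact fun p => p.2.2.elim
  refine lowerSemicontinuous_lintegral (fun p => ?_) ?_
  · have hm1 := measurable_logLR (hg θ₀ hθ₀).measurable (hg p.1 p.1.2).measurable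
    have hm2 := measurable_logLR (hg θ₀ hθ₀).measurable (hh p.2 p.2.2).measurable
    unfold meanGap
    fun_prop
  · filter_upwards [hg_diff θ₀ hθ₀, (hac θ₀ hθ₀ γ₀ hγ₀).1.ae_le (hh_diff γ₀ hγ₀)] with x hx1 hx2
    have c1 : Continuous fun p : Θ × Γ => Real.log (g p.1 x) :=
      (continuousOn_iff_continuous_domRestrict.1 hx1.2.continuousOn).comp continuous_fst
    have c2 : Continuous fun p : Θ × Γ => Real.log (h p.2 x) :=
      (continuousOn_iff_continuous_domRestrict.1 hx2.2.continuousOn).comp continuous_snd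
    unfold meanGap logLR
    exact ENNReal.continuous_ofReal.comp (by fun_prop)

/-- The Chernoff index is lower semicontinuous in the parameters, so its minimum is attained. -/
lemma exists_min_chernoffIndex (hΘ_nonempty : Θ.Nonempty) (hΓ_nonempty : Γ.Nonempty)
    (hΘ : IsCompact Θ) (hΓ : IsCompact Γ)
    (hg : ∀ θ ∈ Θ, IsDensity μ (g θ)) (hh : ∀ γ ∈ Γ, IsDensity μ (h γ))
    (hac : MutuallyAC μ Θ Γ g h)
    (hg_diff : LogDifferentiable μ Θ g) (hh_diff : LogDifferentiable μ Γ h)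
    (hne : ∀ θ ∈ Θ, ∀ γ ∈ Γ, ¬ ∀ᵐ x ∂(law μ (g θ)), logLR (g θ) (h γ) x = 0) :
    ∃ θ ∈ Θ, ∃ γ ∈ Γ, ∀ θ' ∈ Θ, ∀ γ' ∈ Γ,
      chernoffIndex μ (g θ) (h γ) ≤ chernoffIndex μ (g θ') (h γ') := by
  obtain ⟨θ₀, hθ₀⟩ := hΘ_nonempty
  obtain ⟨γ₀, hγ₀⟩ := hΓ_nonempty
  have hgg : ∀ θ ∈ Θ, ∀ θ' ∈ Θ, law μ (g θ) ≪ law μ (g θ') := fun θ hθ θ' hθ' =>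
    (hac θ hθ γ₀ hγ₀).1.trans (hac θ' hθ' γ₀ hγ₀).2
  have hindex : ∀ p : Θ × Γ, chernoffIndex μ (g p.1) (h p.2)
      = ⨆ z : Set.Icc (0 : ℝ) 1, -ENNReal.log (1 - ∫⁻ x, ENNReal.ofReal
        (meanGap z (logLR (g θ₀) (g p.1) x) (logLR (g θ₀) (h p.2) x)) ∂(law μ (g θ₀))) := by
    rintro ⟨⟨θ, hθ⟩, ⟨γ, hγ⟩⟩
    rw [chernoffIndex_eq_iSup (hg _ hθ) (hh _ hγ) (hac _ hθ _ hγ).1 (hac _ hθ _ hγ).2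
      (hne _ hθ _ hγ)]
    refine iSup_congr fun z => ?_
    have hsum := mgfLR_add_lintegral_meanGap (hg θ₀ hθ₀) (hg _ hθ) (hh _ hγ)
      (hgg _ hθ₀ _ hθ) (hgg _ hθ _ hθ₀) (hac _ hθ₀ _ hγ).1 (hac _ hθ₀ _ hγ).2 z.2
    rw [ENNReal.eq_sub_of_add_eq (fun htop => ?_) hsum]
    rw [htop, add_top] at hsum
    exact ENNReal.top_ne_one hsum
  have hΘs : CompactSpace Θ := isCompact_iff_compactSpace.1 hΘ
  have hΓs : CompactSpace Γ := isCompact_iff_compactSpace.1 hΓ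
  have hlsc : LowerSemicontinuous fun p : Θ × Γ => chernoffIndex μ (g p.1) (h p.2) := by
    simp_rw [hindex]
    refine lowerSemicontinuous_iSup fun z => ?_
    -- The map `t ↦ -log (1 - t)` is continuous and increasing, so it carries the semicontinuity of
    -- the gap integral over to `-log M(z)`.
    refine Continuous.comp_lowerSemicontinuous (g := fun t : ℝ≥0∞ => -ENNReal.log (1 - t)) ?_
      (lowerSemicontinuous_lintegral_meanGap hg hh hac hg_diff hh_diff hθ₀ z) ?_
    · exact continuous_neg.comp (ENNReal.continuous_log.comp
        (ENNReal.continuous_sub_left ENNReal.one_ne_top))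
    · intro s t hst
      exact EReal.neg_le_neg_iff.2 (ENNReal.log_le_log (tsub_le_tsub_left hst 1))
  obtain ⟨p, -, hp⟩ := LowerSemicontinuousOn.exists_isMinOn
    (s := (Set.univ : Set (Θ × Γ))) ⟨(⟨θ₀, hθ₀⟩, ⟨γ₀, hγ₀⟩), trivial⟩ isCompact_univ
    (hlsc.lowerSemicontinuousOn _)
  exact ⟨p.1, p.1.2, p.2, p.2.2, fun θ hθ γ hγ =>
    isMinOn_iff.1 hp (⟨θ, hθ⟩, ⟨γ, hγ⟩) (Set.mem_univ _)⟩

end Minimum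

/-! ### Upper bounds for the error probabilities -/

section UpperBound

lemma eventually_mul_exp_neg_le {a b : ℝ} (ha : 0 < a) (hb : 0 < b) :
    ∀ᶠ n : ℕ in atTop, n * Real.exp (-(n * a)) ≤ b := by
  filter_upwards [eventually_exp_neg_le (half_pos ha) (mul_pos hb (half_pos ha))] with n hn
  have h1 : n * (a / 2) ≤ Real.exp (n * (a / 2)) := by linarith [Real.add_one_le_exp (n * (a / 2))]
  have h2 : Real.exp (-(n * a)) = Real.exp (-(n * (a / 2))) * Real.exp (-(n * (a / 2))) := by
    rw [← Real.exp_add]; ring_nf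
  have h3 : Real.exp (n * (a / 2)) * Real.exp (-(n * (a / 2))) = 1 := by
    rw [← Real.exp_add]; simp
  have h4 : n * (a / 2) * Real.exp (-(n * (a / 2))) ≤ 1 := by
    rw [← h3]; gcongr
  have h5 : n * Real.exp (-(n * a)) * (a / 2) ≤ b * (a / 2) := by
    calc n * Real.exp (-(n * a)) * (a / 2)
        = (n * (a / 2) * Real.exp (-(n * (a / 2)))) * Real.exp (-(n * (a / 2))) := by
          rw [h2]; ring
      _ ≤ 1 * Real.exp (-(n * (a / 2))) := by gcongr
      _ ≤ b * (a / 2) := by linarith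
  exact le_of_mul_le_mul_right h5 (half_pos ha)

/-- Tails lighter than every power, at exponentially growing levels, are superexponentially
small. -/
lemma eventually_tail_le {c η : ℝ} (hc : 0 < c) (hη : 0 < η) (B : ℝ) :
    ∀ᶠ n : ℕ in atTop, n * Real.exp (-(n * c) ^ (1 + η)) ≤ 1 / 2 * Real.exp (-(n * B)) := by
  have h1 : Tendsto (fun n : ℕ => (n * c : ℝ) ^ η) atTop atTop :=
    (tendsto_rpow_atTop hη).comp (tendsto_natCast_atTop_atTop.atTop_mul_const hc)
  -- Once `(n c) ^ η ≥ (B + 1) / c`, the exponent is at least `n (B + 1)`; the surplus `n` absorbs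
  -- the prefactor and the constant `1 / 2`.
  filter_upwards [h1.eventually_ge_atTop ((B + 1) / c), eventually_gt_atTop 0,
    eventually_mul_exp_neg_le one_pos (show (0 : ℝ) < 1 / 2 by norm_num)] with n hn hn0 hn1
  have hnc : 0 < (n * c : ℝ) := by positivity
  have h2 : n * (B + 1) ≤ (n * c : ℝ) ^ (1 + η) := by
    rw [Real.rpow_add hnc, Real.rpow_one]
    calc n * (B + 1) = n * c * ((B + 1) / c) := by field_simp
      _ ≤ _ := by gcongr
  calc n * Real.exp (-(n * c) ^ (1 + η)) ≤ n * Real.exp (-(n * (B + 1))) := by gcongr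
    _ = n * Real.exp (-(n * 1)) * Real.exp (-(n * B)) := by
      rw [mul_assoc, ← Real.exp_add]; ring_nf
    _ ≤ _ := by gcongr

/-- Subexponentially many parameters suffice to approximate the maximized likelihood, as long as
the scores at the observations are at most exponentially large. -/
lemma exists_likelihood_net {d : ℕ} {K : Set (EuclideanSpace ℝ (Fin d))} (hKc : IsCompact K)
    (hK : HasC1Boundary K) (f : EuclideanSpace ℝ (Fin d) → ℝ → ℝ) {ε : ℝ} (hε : 0 < ε) :
    ∃ c > 0, ∀ᶠ n : ℕ in atTop, ∃ T : Finset (EuclideanSpace ℝ (Fin d)),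
      (T : Set (EuclideanSpace ℝ (Fin d))) ⊆ K ∧ (T.card : ℝ) ≤ Real.exp (n * ε) ∧
      ∀ x : Fin n → ℝ, (∀ i, (∀ θ ∈ K, 0 < f θ (x i)) ∧
        ∀ θ ∈ K, ∃ f' : EuclideanSpace ℝ (Fin d) →L[ℝ] ℝ,
          HasFDerivWithinAt (fun θ => Real.log (f θ (x i))) f' K θ ∧
          ‖f'‖ ≤ Real.exp (n * c)) →
      ∀ θ ∈ K, ∃ θ' ∈ T, ∏ i, f θ (x i) ≤ Real.exp 1 * ∏ i, f θ' (x i) := by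
  obtain ⟨C, hC, δ, hδ, hLip⟩ := exists_lipschitz_scale hKc hK
  obtain ⟨A, hA, hnet⟩ := exists_finite_net hKc.isBounded
  -- The mesh is `e ^ (-2 n c)`. With scores up to `e ^ (n c)` the log likelihood then moves by at
  -- most `n C e ^ (-n c) ≤ 1`, while the net has at most `A ^ d e ^ (2 d n c)` points, each factor
  -- being at most `e ^ (n ε / 2)`.
  set c : ℝ := ε / (4 * (d + 1)) with hc
  have hc0 : 0 < c := by positivity
  refine ⟨c, hc0, ?_⟩
  filter_upwards [eventually_exp_neg_le (show 0 < 2 * c by positivity) hδ,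
    eventually_mul_exp_neg_le hc0 (show 0 < 1 / (C + 1) by positivity),
    eventually_exp_neg_le (half_pos hε) (show 0 < 1 / A ^ d by positivity)] with n h1 h2 h3
  have hmesh1 : Real.exp (-(n * (2 * c))) ≤ 1 :=
    Real.exp_le_one_iff.2 (by have : 0 ≤ n * (2 * c) := by positivity
                              linarith)
  obtain ⟨T, hTK, hTcard, hTnet⟩ := hnet _ (Real.exp_pos (-(n * (2 * c)))) hmesh1
  refine ⟨T, hTK, hTcard.trans ?_, ?_⟩
  · have e1 : A / Real.exp (-(n * (2 * c))) = A * Real.exp (n * (2 * c)) := by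
      rw [Real.exp_neg, div_inv_eq_mul]
    rw [e1, mul_pow, ← Real.exp_nat_mul]
    have e2 : A ^ d ≤ Real.exp (n * (ε / 2)) := by
      rw [Real.exp_neg, inv_eq_one_div] at h3
      exact (one_div_le_one_div (Real.exp_pos _) (by positivity)).1 h3
    have e3 : (d : ℝ) * (2 * c) ≤ ε / 2 := by
      have : c * (4 * (d + 1)) = ε := by rw [hc]; field_simp
      nlinarith
    calc A ^ d * Real.exp (d * (n * (2 * c)))
        ≤ Real.exp (n * (ε / 2)) * Real.exp (n * (ε / 2)) := by
          refine mul_le_mul e2 (Real.exp_le_exp.2 ?_) (Real.exp_pos _).le (Real.exp_pos _).le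
          calc (d : ℝ) * (n * (2 * c)) = n * (d * (2 * c)) := by ring
            _ ≤ n * (ε / 2) := by gcongr
      _ = Real.exp (n * ε) := by rw [← Real.exp_add]; ring_nf
  · intro x hx θ hθ
    obtain ⟨θ', hθ', hdist⟩ := hTnet θ hθ
    refine ⟨θ', hθ', ?_⟩
    have hθ'K := hTK hθ'
    have hterm : ∀ i, Real.log (f θ (x i)) - Real.log (f θ' (x i)) ≤
        C * Real.exp (-(n * c)) := by
      intro i
      refine (le_abs_self _).trans
        ((hLip θ hθ θ' hθ'K (hdist.trans_le h1) _ _ (hx i).2).trans ?_)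
      calc C * Real.exp (n * c) * dist θ θ'
          ≤ C * Real.exp (n * c) * Real.exp (-(n * (2 * c))) := by gcongr
        _ = C * Real.exp (-(n * c)) := by rw [mul_assoc, ← Real.exp_add]; ring_nf
    have hsum : ∑ i, Real.log (f θ (x i)) ≤ 1 + ∑ i, Real.log (f θ' (x i)) := by
      have e1 : ∑ i, (Real.log (f θ (x i)) - Real.log (f θ' (x i))) ≤
          ∑ _i : Fin n, C * Real.exp (-(n * c)) := Finset.sum_le_sum fun i _ => hterm i
      rw [Finset.sum_sub_distrib, Finset.sum_const, Finset.card_univ, Fintype.card_fin,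
        nsmul_eq_mul] at e1
      have e2 : n * (C * Real.exp (-(n * c))) ≤ 1 := by
        calc n * (C * Real.exp (-(n * c))) = C * (n * Real.exp (-(n * c))) := by ring
          _ ≤ (C + 1) * (1 / (C + 1)) := by gcongr; linarith
          _ = 1 := by field_simp
      linarith
    have hprod : ∀ τ ∈ K, ∏ i, f τ (x i) = Real.exp (∑ i, Real.log (f τ (x i))) := by
      intro τ hτ
      rw [Real.exp_sum]
      exact Finset.prod_congr rfl fun i _ => (Real.exp_log ((hx i).1 τ hτ)).symm
    rw [hprod θ hθ, hprod θ' hθ'K, ← Real.exp_add]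
    exact Real.exp_le_exp.2 hsum

/-- Markov's inequality for the likelihood ratio of two densities. -/
lemma sampleLaw_likelihood_le {μ : Measure ℝ} {g h : ℝ → ℝ} (hg : IsDensity μ g)
    (hh : IsDensity μ h) {ρ z : ℝ} (hz : z ∈ Set.Icc (0 : ℝ) 1)
    (hM : mgfLR μ g h z ≤ ENNReal.ofReal (Real.exp (-ρ))) (n : ℕ) :
    sampleLaw μ g n {x | (∀ i, 0 < g (x i)) ∧ (∀ i, 0 < h (x i)) ∧
      ∏ i, g (x i) ≤ Real.exp 1 * ∏ i, h (x i)} ≤ ENNReal.ofReal (Real.exp (1 - n * ρ)) := by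
  have hP := hg.isProbabilityMeasure
  have hgm := hg.measurable
  have hhm := hh.measurable
  have hsub : {x : Fin n → ℝ | (∀ i, 0 < g (x i)) ∧ (∀ i, 0 < h (x i)) ∧
      ∏ i, g (x i) ≤ Real.exp 1 * ∏ i, h (x i)} ⊆
      {x | ENNReal.ofReal (Real.exp (-1)) ≤ ∏ i, ENNReal.ofReal ((h (x i) / g (x i)) ^ z)} := by
    rintro x ⟨h1, h2, h3⟩
    have hgp : 0 < ∏ i, g (x i) := Finset.prod_pos fun i _ => h1 i
    have hhp : 0 < ∏ i, h (x i) := Finset.prod_pos fun i _ => h2 i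
    rw [Set.mem_ofPred_eq, ← ENNReal.ofReal_prod_of_nonneg
      fun i _ => Real.rpow_nonneg (div_pos (h2 i) (h1 i)).le z]
    refine ENNReal.ofReal_le_ofReal ?_
    rw [Real.finsetProd_rpow _ _ fun i _ => (div_pos (h2 i) (h1 i)).le, Finset.prod_div_distrib]
    have h4 : Real.exp (-1) ≤ (∏ i, h (x i)) / ∏ i, g (x i) := by
      rw [le_div_iff₀ hgp, Real.exp_neg, inv_mul_le_iff₀ (Real.exp_pos 1)]
      exact h3
    calc Real.exp (-1) ≤ Real.exp (-1) ^ z := by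
          rw [← Real.exp_mul]
          exact Real.exp_le_exp.2 (by linarith [hz.2])
      _ ≤ _ := Real.rpow_le_rpow (Real.exp_pos _).le h4 hz.1
  have hmeas : Measurable fun y => ENNReal.ofReal ((h y / g y) ^ z) := by fun_prop
  refine (measure_mono hsub).trans ((meas_ge_le_lintegral_div ?_ (by simp [Real.exp_pos])
    ENNReal.ofReal_ne_top).trans ?_)
  · exact (Finset.measurable_prod _ fun i _ => hmeas.comp (measurable_pi_apply i)).aemeasurable
  · rw [sampleLaw, lintegral_pi_prod (f := fun _ y => ENNReal.ofReal ((h y / g y) ^ z))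
      fun _ => hmeas, Finset.prod_const, Finset.card_univ, Fintype.card_fin]
    change mgfLR μ g h z ^ n / _ ≤ _
    rw [ENNReal.div_le_iff (by simp [Real.exp_pos]) ENNReal.ofReal_ne_top,
      ← ENNReal.ofReal_mul (Real.exp_pos _).le, ← Real.exp_add]
    refine (pow_le_pow_left₀ zero_le hM n).trans (le_of_eq ?_)
    rw [← ENNReal.ofReal_pow (Real.exp_pos _).le, ← Real.exp_nat_mul]
    ring_nf

/-- Under any member of the first family, the maximized likelihood of the second family exceeds that
of the first with probability at most `e ^ (-n (ρ - ε))`, uniformly over the first family. -/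
lemma eventually_sampleLaw_maxLikelihood_le {dg dh : ℕ} {μ : Measure ℝ}
    {Θ : Set (EuclideanSpace ℝ (Fin dg))} {Γ : Set (EuclideanSpace ℝ (Fin dh))}
    {g : EuclideanSpace ℝ (Fin dg) → ℝ → ℝ} {h : EuclideanSpace ℝ (Fin dh) → ℝ → ℝ}
    (hΓ_nonempty : Γ.Nonempty) (hΓc : IsCompact Γ) (hΓ : HasC1Boundary Γ)
    (hg : ∀ θ ∈ Θ, IsDensity μ (g θ)) (hh : ∀ γ ∈ Γ, IsDensity μ (h γ))
    {S : ℝ → ℝ≥0∞}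
    (hae : ∀ θ ∈ Θ, ∀ᵐ y ∂(law μ (g θ)), (∀ γ ∈ Γ, 0 < h γ y) ∧
      ∀ γ ∈ Γ, ∃ f' : EuclideanSpace ℝ (Fin dh) →L[ℝ] ℝ,
        HasFDerivWithinAt (fun γ => Real.log (h γ y)) f' Γ γ ∧ ‖f'‖ₑ ≤ S y)
    {η x₀ : ℝ} (hη : 0 < η)
    (htail : ∀ x : ℝ, x₀ < x → ∀ θ ∈ Θ, law μ (g θ) {y | ENNReal.ofReal x < S y} ≤
      ENNReal.ofReal (Real.exp (-(Real.log x) ^ (1 + η))))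
    {ρ : ℝ} (hρ : ∀ θ ∈ Θ, ∀ γ ∈ Γ, ∃ z ∈ Set.Icc (0 : ℝ) 1,
      mgfLR μ (g θ) (h γ) z ≤ ENNReal.ofReal (Real.exp (-ρ)))
    {ε : ℝ} (hε : 0 < ε) :
    ∀ᶠ n : ℕ in atTop, ∀ θ ∈ Θ,
      sampleLaw μ (g θ) n {x | maxLikelihood Θ g x ≤ maxLikelihood Γ h x} ≤
        ENNReal.ofReal (Real.exp (-(n * (ρ - ε)))) := by
  obtain ⟨c, hc, hnet⟩ := exists_likelihood_net hΓc hΓ h (half_pos hε)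
  have hgrow : Tendsto (fun n : ℕ => Real.exp (n * c)) atTop atTop :=
    Real.tendsto_exp_atTop.comp (tendsto_natCast_atTop_atTop.atTop_mul_const hc)
  filter_upwards [hnet, hgrow.eventually_gt_atTop x₀, eventually_tail_le hc hη (ρ - ε),
    eventually_exp_neg_le (half_pos hε) (show 0 < 1 / 2 * Real.exp (-1) by positivity)]
    with n hn hx₀ htail_n hdecay θ hθ
  obtain ⟨T, hTΓ, hTcard, hT⟩ := hn
  have hP := (hg θ hθ).isProbabilityMeasure
  -- The bad observations: a regularity property fails, which has probability zero, or the score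
  -- exceeds `e ^ (n c)`.
  set A : Set ℝ := {y | ¬(0 < g θ y ∧ ((∀ γ ∈ Γ, 0 < h γ y) ∧
    ∀ γ ∈ Γ, ∃ f' : EuclideanSpace ℝ (Fin dh) →L[ℝ] ℝ,
        HasFDerivWithinAt (fun γ => Real.log (h γ y)) f' Γ γ ∧ ‖f'‖ₑ ≤ S y) ∧
    ¬ ENNReal.ofReal (Real.exp (n * c)) < S y)} with hA
  have hAle : law μ (g θ) A ≤ ENNReal.ofReal (Real.exp (-(n * c) ^ (1 + η))) := by
    have h1 := htail _ hx₀ θ hθ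
    rw [Real.log_exp] at h1
    refine le_trans (measure_mono_ae ?_) h1
    filter_upwards [(hg θ hθ).ae_pos, hae θ hθ] with y hy1 hy2 hyA
    by_contra hcon
    exact hyA ⟨hy1, hy2, hcon⟩
  let R : EuclideanSpace ℝ (Fin dh) → Set (Fin n → ℝ) := fun γ =>
    {x | (∀ i, 0 < g θ (x i)) ∧ (∀ i, 0 < h γ (x i)) ∧
      ∏ i, g θ (x i) ≤ Real.exp 1 * ∏ i, h γ (x i)}
  have hcover : {x : Fin n → ℝ | maxLikelihood Θ g x ≤ maxLikelihood Γ h x} ⊆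
      {x | ∃ i, x i ∈ A} ∪ ⋃ γ ∈ T, R γ := by
    intro x hx
    by_cases hxA : ∃ i, x i ∈ A
    · exact Or.inl hxA
    right
    simp only [hA, Set.mem_ofPred_eq, not_exists, not_not] at hxA
    have hxT := hT x fun i => ⟨(hxA i).2.1.1, fun γ hγ => by
      obtain ⟨f', hf', hf'S⟩ := (hxA i).2.1.2 γ hγ
      have h1 := hf'S.trans (not_lt.1 (hxA i).2.2)
      rw [← ofReal_norm, ENNReal.ofReal_le_ofReal_iff (Real.exp_pos _).le] at h1
      exact ⟨f', hf', h1⟩⟩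
    obtain ⟨γ₁, hγ₁⟩ := hΓ_nonempty
    obtain ⟨γ₂, hγ₂, -⟩ := hxT γ₁ hγ₁
    obtain ⟨γ, hγ, hγmax⟩ := T.exists_max_image (fun γ => ∏ i, h γ (x i)) ⟨γ₂, hγ₂⟩
    refine Set.mem_iUnion₂.2 ⟨γ, hγ, fun i => (hxA i).1, fun i => (hxA i).2.1.1 γ (hTΓ hγ), ?_⟩
    have hpos : 0 ≤ Real.exp 1 * ∏ i, h γ (x i) :=
      mul_nonneg (Real.exp_pos 1).le
        (Finset.prod_nonneg fun i _ => ((hxA i).2.1.1 γ (hTΓ hγ)).le)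
    rw [← ENNReal.ofReal_le_ofReal_iff hpos,
      ENNReal.ofReal_prod_of_nonneg fun i _ => (hxA i).1.le]
    -- The maximized likelihood of the true family is bounded below by its value at the true `θ`, so
    -- only the other family needs a net.
    calc ∏ i, ENNReal.ofReal (g θ (x i)) ≤ maxLikelihood Θ g x :=
          le_iSup₂ (f := fun θ (_ : θ ∈ Θ) => ∏ i, ENNReal.ofReal (g θ (x i))) θ hθ
      _ ≤ maxLikelihood Γ h x := hx
      _ ≤ _ := by
        refine iSup₂_le fun γ' hγ' => ?_
        rw [← ENNReal.ofReal_prod_of_nonneg fun i _ => ((hxA i).2.1.1 γ' hγ').le]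
        refine ENNReal.ofReal_le_ofReal ?_
        obtain ⟨γ₃, hγ₃, hle⟩ := hxT γ' hγ'
        exact hle.trans (mul_le_mul_of_nonneg_left (hγmax γ₃ hγ₃) (Real.exp_pos 1).le)
  have hR : ∀ γ ∈ T, sampleLaw μ (g θ) n (R γ) ≤ ENNReal.ofReal (Real.exp (1 - n * ρ)) := by
    intro γ hγ
    obtain ⟨z, hz, hM⟩ := hρ θ hθ γ (hTΓ hγ)
    exact sampleLaw_likelihood_le (hg θ hθ) (hh γ (hTΓ hγ)) hz hM n
  calc sampleLaw μ (g θ) n {x | maxLikelihood Θ g x ≤ maxLikelihood Γ h x}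
      ≤ sampleLaw μ (g θ) n {x | ∃ i, x i ∈ A} + sampleLaw μ (g θ) n (⋃ γ ∈ T, R γ) :=
        (measure_mono hcover).trans (measure_union_le _ _)
    _ ≤ n * ENNReal.ofReal (Real.exp (-(n * c) ^ (1 + η)))
        + ∑ γ ∈ T, ENNReal.ofReal (Real.exp (1 - n * ρ)) := by
        refine add_le_add ((pi_exists_mem_le A).trans (by gcongr)) ?_
        exact (measure_biUnion_finset_le T R).trans (Finset.sum_le_sum hR)
    _ = ENNReal.ofReal (n * Real.exp (-(n * c) ^ (1 + η)) + T.card * Real.exp (1 - n * ρ)) := by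
        rw [Finset.sum_const, nsmul_eq_mul, ENNReal.ofReal_add (by positivity) (by positivity),
          ENNReal.ofReal_mul (by positivity), ENNReal.ofReal_mul (by positivity),
          ENNReal.ofReal_natCast, ENNReal.ofReal_natCast]
    _ ≤ ENNReal.ofReal (Real.exp (-(n * (ρ - ε)))) := by
        refine ENNReal.ofReal_le_ofReal ?_
        have h1 : T.card * Real.exp (1 - n * ρ) ≤ 1 / 2 * Real.exp (-(n * (ρ - ε))) := by
          calc T.card * Real.exp (1 - n * ρ)
              ≤ Real.exp (n * (ε / 2)) * Real.exp (1 - n * ρ) := by gcongr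
            _ = Real.exp (-(n * (ε / 2))) * (Real.exp 1 * Real.exp (-(n * (ρ - ε)))) := by
              rw [← Real.exp_add, ← Real.exp_add, ← Real.exp_add]; ring_nf
            _ ≤ 1 / 2 * Real.exp (-1) * (Real.exp 1 * Real.exp (-(n * (ρ - ε)))) := by gcongr
            _ = 1 / 2 * (Real.exp (-1) * Real.exp 1) * Real.exp (-(n * (ρ - ε))) := by ring
            _ = _ := by rw [← Real.exp_add]; simp
        linarith

end UpperBound

/-! ### From exponential bounds to the asymptotic statement -/

section Assembly

open ProbabilityTheory

variable {dg dh : ℕ} {μ : Measure ℝ} {Θ : Set (EuclideanSpace ℝ (Fin dg))}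
  {Γ : Set (EuclideanSpace ℝ (Fin dh))} {g : EuclideanSpace ℝ (Fin dg) → ℝ → ℝ}
  {h : EuclideanSpace ℝ (Fin dh) → ℝ → ℝ}

/-- The degenerate quotients agree with the comparison: `0 / 0 = 0` and `∞ / ∞ = 0` do not reject,
while a positive number over `0` is `∞` and does. -/
lemma mem_rejectRegion_one {n : ℕ} {x : Fin n → ℝ} :
    x ∈ rejectRegion Θ Γ g h 1 n ↔ maxLikelihood Θ g x < maxLikelihood Γ h x := by
  change 1 < maxLikelihood Γ h x / maxLikelihood Θ g x ↔ _
  by_cases hb : maxLikelihood Θ g x = ∞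
  · simp [hb]
  by_cases ha : maxLikelihood Θ g x = 0
  · rw [ha, pos_iff_ne_zero]
    by_cases hc : maxLikelihood Γ h x = 0
    · simp [hc]
    · simp [ENNReal.div_zero hc, hc]
  · rw [ENNReal.lt_div_iff_mul_lt (Or.inl ha) (Or.inl hb), one_mul]

/-- Separation enters the argument only through the distinctness of the two laws in each pair;
compactness then makes the minimal index positive. -/
lemma CompletelySeparated.not_ae_logLR_eq_zero (hA : CompletelySeparated μ Θ Γ g h)
    {θ : EuclideanSpace ℝ (Fin dg)} (hθ : θ ∈ Θ) {γ : EuclideanSpace ℝ (Fin dh)} (hγ : γ ∈ Γ) :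
    ¬ ∀ᵐ x ∂(law μ (g θ)), logLR (g θ) (h γ) x = 0 := by
  intro hcon
  have hpos : 0 < expectation (law μ (g θ)) (fun x => Real.log (g θ x) - Real.log (h γ x)) :=
    lt_of_lt_of_le hA ((iInf₂_le θ hθ).trans (iInf₂_le γ hγ))
  have hz : ∀ s : ℝ, ∫⁻ x, ENNReal.ofReal (s * (Real.log (g θ x) - Real.log (h γ x)))
      ∂(law μ (g θ)) = 0 := by
    intro s
    rw [← lintegral_zero (μ := law μ (g θ))]
    refine lintegral_congr_ae ?_
    filter_upwards [hcon] with x hx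
    have : Real.log (g θ x) - Real.log (h γ x) = 0 := by
      unfold logLR at hx
      linarith
    simp [this]
  have h1 := hz 1
  have h2 := hz (-1)
  simp only [one_mul] at h1
  simp only [neg_one_mul] at h2
  unfold expectation at hpos
  rw [h1, h2] at hpos
  simp at hpos

lemma enorm_gradientWithin {d : ℕ} (f : EuclideanSpace ℝ (Fin d) → ℝ)
    (K : Set (EuclideanSpace ℝ (Fin d))) (p : EuclideanSpace ℝ (Fin d)) :
    ‖gradientWithin f K p‖ₑ = ‖fderivWithin ℝ f K p‖ₑ := by
  rw [← ofReal_norm, ← ofReal_norm, gradientWithin, LinearIsometryEquiv.norm_map]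

/-- The gradient of `l` in `θ` is minus that of `log g_θ` and does not involve `γ`, so any `γ`
serves. The existential form takes the derivative that `fderivWithin` selects and needs no
uniqueness of derivatives within `Θ`. -/
lemma exists_hasFDerivWithinAt_le_scoreSup₁ (hΓ : Γ.Nonempty) {x : ℝ}
    (hd : DifferentiableOn ℝ (fun θ => Real.log (g θ x)) Θ)
    {θ : EuclideanSpace ℝ (Fin dg)} (hθ : θ ∈ Θ) :
    ∃ f' : EuclideanSpace ℝ (Fin dg) →L[ℝ] ℝ, HasFDerivWithinAt (fun θ => Real.log (g θ x)) f' Θ θ ∧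
      ‖f'‖ₑ ≤ scoreSup₁ Θ Γ g h x := by
  obtain ⟨γ, hγ⟩ := hΓ
  have h1 : HasFDerivWithinAt (fun θ' => logLR (g θ') (h γ) x)
      (fderivWithin ℝ (fun θ' => logLR (g θ') (h γ) x) Θ θ) Θ θ :=
    ((hd θ hθ).const_sub _).hasFDerivWithinAt
  refine ⟨-fderivWithin ℝ (fun θ' => logLR (g θ') (h γ) x) Θ θ, ?_, ?_⟩
  · simpa [logLR] using h1.const_sub (Real.log (h γ x))
  · refine le_trans (le_of_eq ?_) (le_iSup₂_of_le θ hθ (le_iSup₂_of_le γ hγ le_rfl))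
    rw [enorm_gradientWithin, enorm_neg]

lemma exists_hasFDerivWithinAt_le_scoreSup₂ (hΘ : Θ.Nonempty) {x : ℝ}
    (hd : DifferentiableOn ℝ (fun γ => Real.log (h γ x)) Γ)
    {γ : EuclideanSpace ℝ (Fin dh)} (hγ : γ ∈ Γ) :
    ∃ f' : EuclideanSpace ℝ (Fin dh) →L[ℝ] ℝ, HasFDerivWithinAt (fun γ => Real.log (h γ x)) f' Γ γ ∧
      ‖f'‖ₑ ≤ scoreSup₂ Θ Γ g h x := by
  obtain ⟨θ, hθ⟩ := hΘ
  have h1 : HasFDerivWithinAt (fun γ' => logLR (g θ) (h γ') x)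
      (fderivWithin ℝ (fun γ' => logLR (g θ) (h γ') x) Γ γ) Γ γ :=
    ((hd γ hγ).sub_const _).hasFDerivWithinAt
  refine ⟨fderivWithin ℝ (fun γ' => logLR (g θ) (h γ') x) Γ γ, ?_, ?_⟩
  · simpa [logLR] using h1.add_const (Real.log (g θ x))
  · refine le_trans (le_of_eq ?_) (le_iSup₂_of_le θ hθ (le_iSup₂_of_le γ hγ le_rfl))
    rw [enorm_gradientWithin]

/-- The tail bound for a single member of each family. -/
lemma law_score_tail_le {S : ℝ → ℝ≥0∞} {x : ℝ} {b : ℝ≥0∞}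
    (hb : (⨆ θ ∈ Θ, ⨆ γ ∈ Γ, max (law μ (g θ) {y | ENNReal.ofReal x < S y})
      (law μ (h γ) {y | ENNReal.ofReal x < S y})) ≤ b)
    {θ : EuclideanSpace ℝ (Fin dg)} (hθ : θ ∈ Θ) {γ : EuclideanSpace ℝ (Fin dh)} (hγ : γ ∈ Γ) :
    law μ (g θ) {y | ENNReal.ofReal x < S y} ≤ b ∧
      law μ (h γ) {y | ENNReal.ofReal x < S y} ≤ b := by
  simp only [iSup_le_iff] at hb
  exact max_le_iff.1 (hb θ hθ γ hγ)

lemma tendsto_toReal_div_of_eventually_bounds {a : ℕ → EReal} {ρ : ℝ}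
    (hlow : ∀ ε > 0, ∀ᶠ n : ℕ in atTop, ((-(n * (ρ + ε)) : ℝ) : EReal) ≤ a n)
    (hup : ∀ ε > 0, ∀ᶠ n : ℕ in atTop, a n ≤ ((-(n * (ρ - ε)) : ℝ) : EReal)) :
    Tendsto (fun n => (a n).toReal / n) atTop (𝓝 (-ρ)) := by
  rw [Metric.tendsto_nhds]
  intro ε hε
  filter_upwards [hlow (ε / 2) (half_pos hε), hup (ε / 2) (half_pos hε), eventually_gt_atTop 0]
    with n h1 h2 hn
  have hn0 : (0 : ℝ) < n := Nat.cast_pos.2 hn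
  obtain ⟨r, hr⟩ : ∃ r : ℝ, a n = r :=
    ⟨(a n).toReal, (EReal.coe_toReal (ne_top_of_le_ne_top (EReal.coe_ne_top _) h2)
      (ne_bot_of_le_ne_bot (EReal.coe_ne_bot _) h1)).symm⟩
  rw [hr, EReal.coe_le_coe_iff] at h1 h2
  rw [hr, EReal.toReal_coe, Real.dist_eq, sub_neg_eq_add]
  have h3 : -(ρ + ε / 2) ≤ r / n := by rw [le_div_iff₀ hn0]; linarith
  have h4 : r / n ≤ -(ρ - ε / 2) := by rw [div_le_iff₀ hn0]; linarith
  rw [abs_lt]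
  constructor <;> linarith

lemma log_exp_le_supLogProb {d n : ℕ} {K : Set (EuclideanSpace ℝ (Fin d))}
    {f : EuclideanSpace ℝ (Fin d) → ℝ → ℝ} {C : Set (Fin n → ℝ)} {r : ℝ}
    {θ : EuclideanSpace ℝ (Fin d)} (hθ : θ ∈ K)
    (hr : ENNReal.ofReal (Real.exp r) ≤ sampleLaw μ (f θ) n C) :
    (r : EReal) ≤ supLogProb μ K f C := by
  refine le_iSup₂_of_le θ hθ ?_
  have := ENNReal.log_le_log hr
  rwa [ENNReal.log_ofReal_of_pos (Real.exp_pos r), Real.log_exp] at this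

lemma supLogProb_le {d n : ℕ} {K : Set (EuclideanSpace ℝ (Fin d))}
    {f : EuclideanSpace ℝ (Fin d) → ℝ → ℝ} {C : Set (Fin n → ℝ)} {r : ℝ}
    (hr : ∀ θ ∈ K, sampleLaw μ (f θ) n C ≤ ENNReal.ofReal (Real.exp r)) :
    supLogProb μ K f C ≤ (r : EReal) := by
  refine iSup₂_le fun θ hθ => ?_
  have := ENNReal.log_le_log (hr θ hθ)
  rwa [ENNReal.log_ofReal_of_pos (Real.exp_pos r), Real.log_exp] at this

end Assembly

end SeparateFamilies

/-! ### The theorem -/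

open SeparateFamilies in
theorem theorem1 {dg dh : ℕ} (μ : MeasureTheory.Measure ℝ)
    (Θ : Set (EuclideanSpace ℝ (Fin dg))) (Γ : Set (EuclideanSpace ℝ (Fin dh)))
    (g : EuclideanSpace ℝ (Fin dg) → ℝ → ℝ) (h : EuclideanSpace ℝ (Fin dh) → ℝ → ℝ)
    (hΘ_nonempty : Θ.Nonempty) (hΓ_nonempty : Γ.Nonempty)
    (hg_density : ∀ θ ∈ Θ, IsDensity μ (g θ)) (hh_density : ∀ γ ∈ Γ, IsDensity μ (h γ))
    (h_ac : MutuallyAC μ Θ Γ g h)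
    (hg_diff : LogDifferentiable μ Θ g) (hh_diff : LogDifferentiable μ Γ h)
    (hA1 : CompletelySeparated μ Θ Γ g h)
    (hA2_Θ : IsCompact Θ ∧ HasC1Boundary Θ) (hA2_Γ : IsCompact Γ ∧ HasC1Boundary Γ)
    (hA3 : ScoreTail μ Θ Γ g h) :
    ∃ ρ : ℝ,
      IsLeast {r : EReal | ∃ θ ∈ Θ, ∃ γ ∈ Γ, chernoffIndex μ (g θ) (h γ) = r} (ρ : EReal) ∧
      AsympEquiv (fun n => supLogProb μ Θ g (rejectRegion Θ Γ g h 1 n))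
        (fun n => supLogProb μ Γ h (rejectRegion Θ Γ g h 1 n)ᶜ) ∧
      AsympEquiv (fun n => supLogProb μ Γ h (rejectRegion Θ Γ g h 1 n)ᶜ)
        (fun n => ((-(n * ρ) : ℝ) : EReal)) := by
  have hne : ∀ θ ∈ Θ, ∀ γ ∈ Γ, ¬ ∀ᵐ x ∂(law μ (g θ)), logLR (g θ) (h γ) x = 0 :=
    fun θ hθ γ hγ => hA1.not_ae_logLR_eq_zero hθ hγ
  obtain ⟨θ, hθ, γ, hγ, hmin⟩ := exists_min_chernoffIndex hΘ_nonempty hΓ_nonempty hA2_Θ.1 hA2_Γ.1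
    hg_density hh_density h_ac hg_diff hh_diff hne
  obtain ⟨hgh, hhg⟩ := h_ac θ hθ γ hγ
  obtain ⟨z, hz, hzpos, hzmin, hindex⟩ := exists_chernoffIndex_eq_neg_log (hg_density θ hθ)
    (hh_density γ hγ) hgh hhg (hne θ hθ γ hγ)
  have hPg := (hg_density θ hθ).isProbabilityMeasure
  have hPh := (hh_density γ hγ).isProbabilityMeasure
  have hhalf : (1 / 2 : ℝ) ∈ Set.Icc (0 : ℝ) 1 := ⟨by norm_num, by norm_num⟩
  have hhalf_lt := mgf_half_lt_one (hg_density θ hθ) (hh_density γ hγ) hgh hhg (hne θ hθ γ hγ)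
  set ρ : ℝ := -Real.log (ProbabilityTheory.mgf (logLR (g θ) (h γ)) (law μ (g θ)) z) with hρ
  have hexpρ : Real.exp (-ρ) = ProbabilityTheory.mgf (logLR (g θ) (h γ)) (law μ (g θ)) z := by
    rw [hρ, neg_neg, Real.exp_log hzpos]
  have hρpos : 0 < ρ := by
    rw [hρ, neg_pos]
    exact Real.log_neg hzpos ((hzmin _ hhalf).trans_lt hhalf_lt)
  -- Minimality of `ρ`, read as a bound on the affinity of every pair at its own optimal exponent.
  have hM : ∀ θ' ∈ Θ, ∀ γ' ∈ Γ, ∃ z ∈ Set.Icc (0 : ℝ) 1,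
      mgfLR μ (g θ') (h γ') z ≤ ENNReal.ofReal (Real.exp (-ρ)) := by
    intro θ' hθ' γ' hγ'
    obtain ⟨hgh', hhg'⟩ := h_ac θ' hθ' γ' hγ'
    obtain ⟨z', hz', hzpos', -, hindex'⟩ := exists_chernoffIndex_eq_neg_log (hg_density θ' hθ')
      (hh_density γ' hγ') hgh' hhg' (hne θ' hθ' γ' hγ')
    refine ⟨z', hz', ?_⟩
    rw [mgfLR_eq_ofReal_mgf (hg_density θ' hθ') (hh_density γ' hγ') hgh' hhg' hz']
    have h1 := hmin θ' hθ' γ' hγ'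
    rw [hindex, hindex', EReal.coe_le_coe_iff] at h1
    refine ENNReal.ofReal_le_ofReal ?_
    rw [← Real.log_le_iff_le_exp hzpos']
    linarith
  have hM' : ∀ γ' ∈ Γ, ∀ θ' ∈ Θ, ∃ z ∈ Set.Icc (0 : ℝ) 1,
      mgfLR μ (h γ') (g θ') z ≤ ENNReal.ofReal (Real.exp (-ρ)) := by
    intro γ' hγ' θ' hθ'
    obtain ⟨z', hz', hle⟩ := hM θ' hθ' γ' hγ'
    refine ⟨1 - z', ⟨by linarith [hz'.2], by linarith [hz'.1]⟩, ?_⟩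
    rwa [mgfLR_swap (hg_density θ' hθ') (hh_density γ' hγ') (h_ac θ' hθ' γ' hγ').1
      (h_ac θ' hθ' γ' hγ').2, sub_sub_cancel]
  obtain ⟨η, hη, x₀, -, htail⟩ := hA3
  -- The first-kind error needs a net of `Γ`, hence `scoreSup₂`; the second-kind error below
  -- exchanges the families. Both bounds include the ties, so strictness of the rejection rule is
  -- immaterial.
  have hup₁ : ∀ ε > 0, ∀ᶠ n : ℕ in Filter.atTop, ∀ θ' ∈ Θ,
      sampleLaw μ (g θ') n (rejectRegion Θ Γ g h 1 n) ≤
        ENNReal.ofReal (Real.exp (-(n * (ρ - ε)))) := by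
    intro ε hε
    filter_upwards [eventually_sampleLaw_maxLikelihood_le hΓ_nonempty hA2_Γ.1 hA2_Γ.2 hg_density
      hh_density (S := scoreSup₂ Θ Γ g h) (fun θ' hθ' =>
        (h_ac θ' hθ' γ hγ).1.ae_le ((hh_diff γ hγ).mono fun y hy =>
          ⟨hy.1, fun γ' hγ' => exists_hasFDerivWithinAt_le_scoreSup₂ hΘ_nonempty hy.2 hγ'⟩)) hη
      (fun x hx θ' hθ' => (law_score_tail_le (htail x hx _ (Or.inr rfl)) hθ' hγ).1) hM hε] with n hn θ' hθ'
    exact (MeasureTheory.measure_mono fun x hx => (mem_rejectRegion_one.1 hx).le).trans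
      (hn θ' hθ')
  have hup₂ : ∀ ε > 0, ∀ᶠ n : ℕ in Filter.atTop, ∀ γ' ∈ Γ,
      sampleLaw μ (h γ') n (rejectRegion Θ Γ g h 1 n)ᶜ ≤
        ENNReal.ofReal (Real.exp (-(n * (ρ - ε)))) := by
    intro ε hε
    filter_upwards [eventually_sampleLaw_maxLikelihood_le hΘ_nonempty hA2_Θ.1 hA2_Θ.2 hh_density
      hg_density (S := scoreSup₁ Θ Γ g h) (fun γ' hγ' =>
        (h_ac θ hθ γ' hγ').2.ae_le ((hg_diff θ hθ).mono fun y hy =>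
          ⟨hy.1, fun θ' hθ' => exists_hasFDerivWithinAt_le_scoreSup₁ hΓ_nonempty hy.2 hθ'⟩)) hη
      (fun x hx γ' hγ' => (law_score_tail_le (htail x hx _ (Or.inl rfl)) hθ hγ').2) hM' hε] with n hn γ' hγ'
    exact (MeasureTheory.measure_mono fun x hx => not_lt.1 (mt mem_rejectRegion_one.2 hx)).trans
      (hn γ' hγ')
  -- At the least favourable pair the upper bound for one error forces the lower bound for the
  -- other.
  have hlow₁ : ∀ ε > 0, ∀ᶠ n : ℕ in Filter.atTop, ENNReal.ofReal (Real.exp (-(n * (ρ + ε)))) ≤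
      sampleLaw μ (g θ) n (rejectRegion Θ Γ g h 1 n) := by
    intro ε hε
    refine eventually_exp_le_of_eventually_compl_le
      (measurable_logLR (hg_density θ hθ).measurable (hh_density γ hγ).measurable)
      (law_eq_withDensity (hg_density θ hθ) (hh_density γ hγ) hgh hhg)
      (fun z' hz' => hexpρ.le.trans (hzmin z' hz')) ⟨_, hhalf, hhalf_lt⟩ (fun ε' hε' => ?_) hε
    exact (hup₂ ε' hε').mono fun n hn => hn γ hγ
  have hlow₂ : ∀ ε > 0, ∀ᶠ n : ℕ in Filter.atTop, ENNReal.ofReal (Real.exp (-(n * (ρ + ε)))) ≤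
      sampleLaw μ (h γ) n (rejectRegion Θ Γ g h 1 n)ᶜ := by
    intro ε hε
    have hswap : ∀ z' ∈ Set.Icc (0 : ℝ) 1,
        ProbabilityTheory.mgf (logLR (h γ) (g θ)) (law μ (h γ)) z'
          = ProbabilityTheory.mgf (logLR (g θ) (h γ)) (law μ (g θ)) (1 - z') := by
      intro z' hz'
      have h1 := mgfLR_swap (hg_density θ hθ) (hh_density γ hγ) hgh hhg z'
      rw [mgfLR_eq_ofReal_mgf (hh_density γ hγ) (hg_density θ hθ) hhg hgh hz',
        mgfLR_eq_ofReal_mgf (hg_density θ hθ) (hh_density γ hγ) hgh hhg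
          ⟨by linarith [hz'.2], by linarith [hz'.1]⟩] at h1
      exact (ENNReal.ofReal_eq_ofReal_iff ProbabilityTheory.mgf_nonneg
        ProbabilityTheory.mgf_nonneg).1 h1
    refine eventually_exp_le_of_eventually_compl_le
      (measurable_logLR (hh_density γ hγ).measurable (hg_density θ hθ).measurable)
      (law_eq_withDensity (hh_density γ hγ) (hg_density θ hθ) hhg hgh)
      (fun z' hz' => ?_) ⟨1 / 2, hhalf, ?_⟩ (fun ε' hε' => ?_) hε
    · rw [hswap z' hz']
      exact hexpρ.le.trans (hzmin _ ⟨by linarith [hz'.2], by linarith [hz'.1]⟩)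
    · rw [hswap _ hhalf]
      convert hhalf_lt using 2
      norm_num
    · simp only [compl_compl]
      exact (hup₁ ε' hε').mono fun n hn => hn θ hθ
  have ht₁ := tendsto_toReal_div_of_eventually_bounds
    (a := fun n => supLogProb μ Θ g (rejectRegion Θ Γ g h 1 n))
    (fun ε hε => (hlow₁ ε hε).mono fun n hn => log_exp_le_supLogProb hθ hn)
    (fun ε hε => (hup₁ ε hε).mono fun n hn => supLogProb_le hn)
  have ht₂ := tendsto_toReal_div_of_eventually_bounds
    (a := fun n => supLogProb μ Γ h (rejectRegion Θ Γ g h 1 n)ᶜ)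
    (fun ε hε => (hlow₂ ε hε).mono fun n hn => log_exp_le_supLogProb hγ hn)
    (fun ε hε => (hup₂ ε hε).mono fun n hn => supLogProb_le hn)
  have hρ0 : -ρ ≠ 0 := neg_ne_zero.2 hρpos.ne'
  refine ⟨ρ, ⟨⟨θ, hθ, γ, hγ, hindex⟩, ?_⟩, ?_, ?_⟩
  · rintro _ ⟨θ', hθ', γ', hγ', rfl⟩
    rw [← hindex]
    exact hmin θ' hθ' γ' hγ'
  -- Both normalized logarithms tend to `-ρ`, which is nonzero, so their quotient tends to one and
  -- the factors `n` cancel for `n > 0`.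
  · have h1 := ht₁.div ht₂ hρ0
    rw [div_self hρ0] at h1
    refine h1.congr' ?_
    filter_upwards [Filter.eventually_gt_atTop 0] with n hn
    exact div_div_div_cancel_right₀ (Nat.cast_ne_zero.2 hn.ne') _ _
  · have h1 := ht₂.div_const (-ρ)
    rw [div_self hρ0] at h1
    refine h1.congr fun n => ?_
    rw [EReal.toReal_coe, div_div, mul_neg]
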